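/- **Theorem 8.4 (Full abstraction for normed sequential categories).** If $\mathcal C$ is a normed sequential category, then $K_!(\mathcal C)/{\lesssim}$ is a fully abstract model of PCF. The notions are as follows. *Affine categories.* $\mathcal C$ is a symmetric monoidal closed category $(\otimes, 1, \multimap)$ with finite products whose tensor unit $1$ is terminal, with a comonad in co-Kleisli form ($!A$, $\mathsf{der}_A:{!A}\to A$, $f:{!A}\to B\mapsto f^\dagger:{!A}\to{!B}$, with $f^\dagger;g^\dagger=(f^\dagger;g)^\dagger$, $f^\dagger;\mathsf{der}=f$, $\mathsf{der}^\dagger;f=f$) and natural isomorphisms $!(A\times B)\cong{!A}\otimes{!B}$, $!1\cong1$ making $!$ a strong symmetric monoidal functor from $(\times,1)$ to $(\otimes,1)$, compatibly with the comultiplication $\mathrm{id}^\dagger:{!A}\to{!!A}$. Let $\mathsf{con}_A:{!A}\to{!A}\otimes{!A}$ be the induced contraction. $K_!(\mathcal C)$ is the co-Kleisli category, which is cartesian closed with $A\Rightarrow B={!A}\multimap B$. *Partiality.* There are distinguished maps $\bot_A:1\to A$ with $\bot_{A\times B}=\langle\bot_A,\bot_B\rangle$; $\bot_{A,B}=(A\to1\xrightarrow{\bot_B}B)$.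 A map $f:A\to B$ is *strict* if $\bot_A;f=\bot_B$, and *total* if it is strict and $f\ne\bot_{A,B}$. $\mathcal C_s(A,B)$ and $\mathcal C_t(A,B)$ are the sets of strict and of total maps; homsets and sets of strict maps are pointed by $\bot$. $B$ is *$\pi$-atomic* if for all finite families the canonical map of pointed sets $\sum_i\mathcal C_s(A_i,B)\to\mathcal C_s(\prod_iA_i,B)$ is bijective, and *discrete* if for every $A$ the canonical map $\mathcal C_s(A,B)+\mathcal C(1,B)\to\mathcal C(A,B)$ is bijective (sums of pointed sets identify base points). *Standard datatypes.* A class of *well-opened* objects is given, closed under finite products and such that $A\multimap B$ is well-opened whenever $B$ is. Let $\mathcal T$ be the class of well-opened $\pi$-atomic objects $A$ with $\mathrm{id}_A\ne\bot_{A,A}$. Total maps between objects of $\mathcal T$ are closed under composition, and the functor $\mathcal C(1,-)$ from the resulting category $\mathcal T_t$ to pointed sets has a left adjoint $X_\star\mapsto\widetilde{X_\star}$ whose unit is an isomorphism. So $\widetilde{X_\star}\in\mathcal T$, the points of $\widetilde{X_\star}$ are $\bot$ and distinct points $\bar x\neq\bot$ ($x\in X$), and for $A\in\mathcal T$ and $f_x:1\to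 A$ $(x\in X)$ there is a unique total $[f_x\mid x\in X]:\widetilde{X_\star}\to A$ with $\bar x;[f_x\mid x\in X]=f_x$ for all $x$. *Sequential categories.* $\mathcal C$ is *sequential* if, with all this structure: (A1) every $\widetilde{X_\star}$ is discrete; (A2) every $\widetilde{X_\star}$ is $\pi$-atomic, and $A\multimap B$ is $\pi$-atomic whenever $B$ is; (A3) $(f;\mathsf{der}_B)^\dagger=f$ for all well-opened $A,B$ and $f:{!A}\to{!B}$; (A4) for well-opened $A,B$, $f\mapsto\mathsf{con}_A;(\mathsf{der}_A\otimes\mathrm{id}_{!A});\Lambda^{-1}(f)$ is a bijection from $\mathcal C_s(A,{!A}\multimap B)$ onto $\mathcal C_s(!A,B)$; (A5) for all $A$, $C$ and all well-opened, $\pi$-atomic, discrete $B,D$, the map sending $(g,h)$ to the composite $$A\multimap B\xrightarrow{g\multimap h}{!C}\multimap({!C}\multimap D)\cong({!C}\otimes{!C})\multimap D\xrightarrow{\mathsf{con}_C\multimap\mathrm{id}}{!C}\multimap D$$ is a bijection from $\mathcal C(!C,A)\times\mathcal C_t(B,{!C}\multimap D)$ onto $\mathcal C_t(A\multimap B,{!C}\multimap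 D)$. *PCF* is the simply typed $\lambda$-calculus over the base type $\mathbf{nat}$ with constants $\mathbf Y_T:(T\Rightarrow T)\Rightarrow T$, $\Omega:\mathbf{nat}$, $\underline n:\mathbf{nat}$ and $\mathsf{case}_k:\mathbf{nat}\Rightarrow\mathbf{nat}\Rightarrow\cdots\Rightarrow\mathbf{nat}$ ($k$ branches). $\equiv$ is the congruence generated by $\beta\eta$ and $\mathbf YM\equiv M(\mathbf YM)$. Evaluation of programs (closed terms of type $\mathbf{nat}$) is inductively generated by: $\underline n\Downarrow\underline n$; $M\Downarrow\underline n$ if $M\equiv M'$ and $M'\Downarrow\underline n$; $\mathsf{case}_kPP_0\cdots P_{k-1}\Downarrow\underline n$ if $P\Downarrow\underline i$, $i<k$ and $P_i\Downarrow\underline n$. For terms $M,N$ with $\Gamma\vdash M,N:T$, $M\sqsubseteq_{\Gamma,T}N$ means that $C[M]\Downarrow\underline n$ implies $C[N]\Downarrow\underline n$ for all $n$ and all contexts $C[\cdot]$ that turn terms of type $T$ in context $\Gamma$ into programs. In $K_!(\mathcal C)$, $\mathbf{nat}$ is interpreted by $\widetilde{\mathbb N_\star}$, $\underline n$ by $\bar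 n$, $\Omega$ by $\bot$, and $\mathsf{case}_k$ by $\mathsf{der};[f_i\mid i\in\mathbb N]$ with $f_i=\lambda x_0\ldots x_{k-1}.\,x_i$ for $i<k$ and $f_i=\bot$ for $i\ge k$. Given a fixpoint operator, $\mathbf Y$ is interpreted by the fixpoint of $[\![F\vdash\lambda f.f(Ff)]\!]$. *Normed.* A sequential category $\mathcal C$ is *normed* if 1. it is enriched over algebraic cpo's: each homset is an algebraic directed-complete poset with least element $\bot_{A,B}$; composition, $\otimes$, currying, pairing and $(\cdot)^\dagger$ are Scott continuous (in each argument); and in $\mathcal C(1,\widetilde{X_\star})$, $f\le g$ iff $f=\bot$ or $f=g$. Fixpoints in $K_!(\mathcal C)$ are then the suprema of the chains $f^k\circ\bot$; 2. there is a function $\|\cdot\|$ from compact morphisms to $\mathbb N$ such that, for each PCF type $T=T_1\Rightarrow\cdots\Rightarrow T_p\Rightarrow\mathbf{nat}$, with $\vec A=[\![T_1]\!]\times\cdots\times[\![T_p]\!]$ and $T_i=U_1\Rightarrow\cdots\Rightarrow U_q\Rightarrow\mathbf{nat}$: if $f:1\to[\![T]\!]$ is compact and, up to currying, $$f=\mathsf{con}_{\vec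 A};(m\otimes\mathrm{id}_{!\vec A});\Lambda^{-1}[g_n\mid n\in\mathbb N],$$ where $m:{!\vec A}\to\widetilde{\mathbb N_\star}$ is, in $K_!(\mathcal C)$, the application of the projection $\pi_i$ to $f_j:{!\vec A}\to[\![U_j]\!]$ $(1\le j\le q)$, and $g_n:1\to({!\vec A}\multimap\widetilde{\mathbb N_\star})$ for $n\in\mathbb N$, then the $f_j$ and $g_n$, regarded as points of $[\![T_1\Rightarrow\cdots\Rightarrow T_p\Rightarrow U_j]\!]$ and of $[\![T]\!]$, are compact with norm $<\|f\|$, and $g_n=\bot$ for almost all $n$. *The quotient.* For $f,g:1\to A$ in $K_!(\mathcal C)$, $f\lesssim g$ iff for all $\alpha:A\to\widetilde{\mathbb N_\star}$ in $K_!(\mathcal C)$ and all $n$, $\alpha\circ f=\bar n$ implies $\alpha\circ g=\bar n$; for $f,g:A\to B$, $f\lesssim g$ iff this holds of their names $1\to(A\Rightarrow B)$. $K_!(\mathcal C)/{\lesssim}$, whose homsets are the poset reflections of those of $K_!(\mathcal C)$ under $\lesssim$ with all structure induced, is a poset-enriched cartesian closed category with a fixpoint operator and so interprets PCF. *Conclusion.*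 $K_!(\mathcal C)/{\lesssim}$ is sound and complete: for all $\Gamma$, $T$ and all PCF terms $M,N$ with $\Gamma\vdash M,N:T$, $$[\![M]\!]\le[\![N]\!]\ \text{ in }K_!(\mathcal C)/{\lesssim}\quad\Longleftrightarrow\quad M\sqsubseteq_{\Gamma,T}N.$$ -/

import Mathlib

open CategoryTheory MonoidalCategory SemiCartesianMonoidalCategory Limits

universe v u

set_option linter.checkUnivs false

namespace AxPCF

/-! ### The language PCF

Intrinsically typed terms with de Bruijn variables.  A typing context is a list of types whose head
is the most recently bound variable. -/

inductive Ty : Type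
  | nat : Ty
  | arr : Ty → Ty → Ty

/-- `arrows [T₁, …, Tₖ] U` is `Tₖ ⇒ ⋯ ⇒ T₁ ⇒ U` (the type obtained by abstracting over the whole
context, most recently bound variable first). -/
def arrows : List Ty → Ty → Ty
  | [], U => U
  | T :: Γ, U => arrows Γ (Ty.arr T U)

/-- `natPow k` is `nat ⇒ ⋯ ⇒ nat ⇒ nat` with `k` arguments. -/
def natPow : ℕ → Ty
  | 0 => Ty.nat
  | k + 1 => Ty.arr Ty.nat (natPow k)

inductive Var : List Ty → Ty → Type
  | zero {Γ : List Ty} {T : Ty} : Var (T :: Γ) T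
  | succ {Γ : List Ty} {S T : Ty} : Var Γ T → Var (S :: Γ) T

/-- `Tm Γ T` is the set of PCF terms `M` with `Γ ⊢ M : T`. -/
inductive Tm : List Ty → Ty → Type
  | var {Γ : List Ty} {T : Ty} : Var Γ T → Tm Γ T
  | lam {Γ : List Ty} {S T : Ty} : Tm (S :: Γ) T → Tm Γ (Ty.arr S T)
  | app {Γ : List Ty} {S T : Ty} : Tm Γ (Ty.arr S T) → Tm Γ S → Tm Γ T
  | fix {Γ : List Ty} (T : Ty) : Tm Γ (Ty.arr (Ty.arr T T) T)
  | omega {Γ : List Ty} : Tm Γ Ty.nat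
  | num {Γ : List Ty} (n : ℕ) : Tm Γ Ty.nat
  | case {Γ : List Ty} (k : ℕ) : Tm Γ (Ty.arr Ty.nat (natPow k))

abbrev Ren (Γ Δ : List Ty) : Type := ∀ T : Ty, Var Γ T → Var Δ T

abbrev Sub (Γ Δ : List Ty) : Type := ∀ T : Ty, Var Γ T → Tm Δ T

def Ren.lift {Γ Δ : List Ty} (ρ : Ren Γ Δ) (S : Ty) : Ren (S :: Γ) (S :: Δ)
  | _, Var.zero => Var.zero
  | _, Var.succ x => Var.succ (ρ _ x)

def Tm.rename : {Γ Δ : List Ty} → {T : Ty} → Ren Γ Δ → Tm Γ T → Tm Δ T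
  | _, _, _, ρ, .var x => .var (ρ _ x)
  | _, _, _, ρ, .lam M => .lam (M.rename (ρ.lift _))
  | _, _, _, ρ, .app M N => .app (M.rename ρ) (N.rename ρ)
  | _, _, _, _, .fix T => .fix T
  | _, _, _, _, .omega => .omega
  | _, _, _, _, .num n => .num n
  | _, _, _, _, .case k => .case k

def Tm.weaken {Γ : List Ty} {T : Ty} (S : Ty) (M : Tm Γ T) : Tm (S :: Γ) T :=
  M.rename (fun _ => Var.succ)

def Sub.lift {Γ Δ : List Ty} (σ : Sub Γ Δ) (S : Ty) : Sub (S :: Γ) (S :: Δ)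
  | _, Var.zero => .var Var.zero
  | _, Var.succ x => (σ _ x).weaken S

def Tm.subst : {Γ Δ : List Ty} → {T : Ty} → Sub Γ Δ → Tm Γ T → Tm Δ T
  | _, _, _, σ, .var x => σ _ x
  | _, _, _, σ, .lam M => .lam (M.subst (σ.lift _))
  | _, _, _, σ, .app M N => .app (M.subst σ) (N.subst σ)
  | _, _, _, _, .fix T => .fix T
  | _, _, _, _, .omega => .omega
  | _, _, _, _, .num n => .num n
  | _, _, _, _, .case k => .case k

def Sub.single {Γ : List Ty} {S : Ty} (N : Tm Γ S) : Sub (S :: Γ) Γ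
  | _, Var.zero => N
  | _, Var.succ x => .var x

/-- Structural congruence: the congruence generated by `β`, `η` and `Y M ≡ M (Y M)`. -/
inductive Cong : {Γ : List Ty} → {T : Ty} → Tm Γ T → Tm Γ T → Prop
  | refl {Γ : List Ty} {T : Ty} (M : Tm Γ T) : Cong M M
  | symm {Γ : List Ty} {T : Ty} {M N : Tm Γ T} : Cong M N → Cong N M
  | trans {Γ : List Ty} {T : Ty} {M N P : Tm Γ T} : Cong M N → Cong N P → Cong M P
  | lam {Γ : List Ty} {S T : Ty} {M N : Tm (S :: Γ) T} : Cong M N → Cong (.lam M) (.lam N)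
  | app {Γ : List Ty} {S T : Ty} {M M' : Tm Γ (Ty.arr S T)} {N N' : Tm Γ S} :
      Cong M M' → Cong N N' → Cong (.app M N) (.app M' N')
  | beta {Γ : List Ty} {S T : Ty} (M : Tm (S :: Γ) T) (N : Tm Γ S) :
      Cong (.app (.lam M) N) (M.subst (Sub.single N))
  | eta {Γ : List Ty} {S T : Ty} (M : Tm Γ (Ty.arr S T)) :
      Cong (.lam (.app (M.weaken S) (.var Var.zero))) M
  | unfold {Γ : List Ty} {T : Ty} (M : Tm Γ (Ty.arr T T)) :
      Cong (.app (.fix T) M) (.app M (.app (.fix T) M))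

/-- `appPow k M P` is `M P₀ ⋯ Pₖ₋₁`. -/
def appPow {Γ : List Ty} : (k : ℕ) → Tm Γ (natPow k) → (Fin k → Tm Γ Ty.nat) → Tm Γ Ty.nat
  | 0, M, _ => M
  | k + 1, M, P => appPow k (.app M (P 0)) (fun i => P i.succ)

/-- The evaluation relation between programs (closed terms of type `nat`) and numerals. -/
inductive Eval : Tm [] Ty.nat → ℕ → Prop
  | conv {M M' : Tm [] Ty.nat} {n : ℕ} : Cong M M' → Eval M' n → Eval M n
  | num (n : ℕ) : Eval (.num n) n
  | case {k : ℕ} {P : Tm [] Ty.nat} {Q : Fin k → Tm [] Ty.nat} {n : ℕ} (i : Fin k) :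
      Eval P i → Eval (Q i) n → Eval (appPow k (.app (.case k) P) Q) n

/-- `Ctxt Γ T Δ U`: contexts of type `U` in scope `Δ` whose holes are to be filled by a term
`Γ ⊢ M : T`.  A hole may sit in any scope `Δ` that declares the variables of `Γ`
(and possibly others); these are captured. -/
inductive Ctxt (Γ : List Ty) (T : Ty) : List Ty → Ty → Type
  | hole {Δ : List Ty} (ρ : Ren Γ Δ) (hρ : ∀ S, Function.Injective (ρ S)) : Ctxt Γ T Δ T
  | term {Δ : List Ty} {U : Ty} : Tm Δ U → Ctxt Γ T Δ U
  | lam {Δ : List Ty} {S U : Ty} : Ctxt Γ T (S :: Δ) U → Ctxt Γ T Δ (Ty.arr S U)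
  | app {Δ : List Ty} {S U : Ty} :
      Ctxt Γ T Δ (Ty.arr S U) → Ctxt Γ T Δ S → Ctxt Γ T Δ U

def Ctxt.plug {Γ : List Ty} {T : Ty} (M : Tm Γ T) :
    {Δ : List Ty} → {U : Ty} → Ctxt Γ T Δ U → Tm Δ U
  | _, _, .hole ρ _ => M.rename ρ
  | _, _, .term N => N
  | _, _, .lam K => .lam (K.plug M)
  | _, _, .app K L => .app (K.plug M) (L.plug M)

/-- The observational preorder `M ⊑ N` at `Γ, T`. -/
def ObsLE {Γ : List Ty} {T : Ty} (M N : Tm Γ T) : Prop :=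
  ∀ (K : Ctxt Γ T [] Ty.nat) (n : ℕ), Eval (K.plug M) n → Eval (K.plug N) n

/-! ### Cartesian closed categories and models of PCF -/

/-- A cartesian closed category with chosen structure; composition is in diagrammatic order. -/
structure CartClosed where
  Obj : Type u
  Hom : Obj → Obj → Type v
  id : (A : Obj) → Hom A A
  comp : {A B D : Obj} → Hom A B → Hom B D → Hom A D
  id_comp : ∀ {A B : Obj} (f : Hom A B), comp (id A) f = f
  comp_id : ∀ {A B : Obj} (f : Hom A B), comp f (id B) = f
  assoc : ∀ {A B D E : Obj} (f : Hom A B) (g : Hom B D) (h : Hom D E),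
    comp (comp f g) h = comp f (comp g h)
  one : Obj
  toOne : (A : Obj) → Hom A one
  toOne_unique : ∀ {A : Obj} (f : Hom A one), f = toOne A
  prod : Obj → Obj → Obj
  fst : (A B : Obj) → Hom (prod A B) A
  snd : (A B : Obj) → Hom (prod A B) B
  pair : {X A B : Obj} → Hom X A → Hom X B → Hom X (prod A B)
  pair_fst : ∀ {X A B : Obj} (f : Hom X A) (g : Hom X B), comp (pair f g) (fst A B) = f
  pair_snd : ∀ {X A B : Obj} (f : Hom X A) (g : Hom X B), comp (pair f g) (snd A B) = g
  pair_eta : ∀ {X A B : Obj} (h : Hom X (prod A B)),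
    pair (comp h (fst A B)) (comp h (snd A B)) = h
  exp : Obj → Obj → Obj
  ev : (A B : Obj) → Hom (prod A (exp A B)) B
  curry : {X A B : Obj} → Hom (prod A X) B → Hom X (exp A B)
  curry_ev : ∀ {X A B : Obj} (f : Hom (prod A X) B),
    comp (pair (fst A X) (comp (snd A X) (curry f))) (ev A B) = f
  curry_eta : ∀ {X A B : Obj} (g : Hom X (exp A B)),
    curry (comp (pair (fst A X) (comp (snd A X) g)) (ev A B)) = g

/-- Interpretation of types, given the interpretation of `⇒` and of the base type. -/
def Ty.interp {O : Type u} (exp : O → O → O) (b : O) : Ty → O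
  | .nat => b
  | .arr S T => exp (S.interp exp b) (T.interp exp b)

/-- Interpretation of typing contexts as products. -/
def ctxInterp {O : Type u} (one : O) (prod exp : O → O → O) (b : O) : List Ty → O
  | [] => one
  | T :: Γ => prod (T.interp exp b) (ctxInterp one prod exp b Γ)

namespace CartClosed

variable (K : CartClosed.{v, u}) (b : K.Obj)

abbrev ty (T : Ty) : K.Obj := T.interp K.exp b

abbrev ctx (Γ : List Ty) : K.Obj := ctxInterp K.one K.prod K.exp b Γ

def lookup : {Γ : List Ty} → {T : Ty} → Var Γ T → K.Hom (K.ctx b Γ) (K.ty b T)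
  | T :: Γ, _, .zero => K.fst (K.ty b T) (K.ctx b Γ)
  | S :: Γ, _, .succ x => K.comp (K.snd (K.ty b S) (K.ctx b Γ)) (lookup x)

/-- Application of a parametrised function to a parametrised argument. -/
def appl {X A B : K.Obj} (f : K.Hom X (K.exp A B)) (a : K.Hom X A) : K.Hom X B :=
  K.comp (K.pair a f) (K.ev A B)

/-- Abstraction over a whole context. -/
def close : (Γ : List Ty) → {U : Ty} → K.Hom (K.ctx b Γ) (K.ty b U) →
    K.Hom K.one (K.ty b (arrows Γ U))
  | [], _, f => f
  | T :: Γ, U, f => close Γ (U := Ty.arr T U) (K.curry f)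

/-- Application of a function of type `arrows Δ U` to one argument for each member of `Δ`. -/
def applVars {X : K.Obj} : (Δ : List Ty) → {U : Ty} → K.Hom X (K.ty b (arrows Δ U)) →
    (∀ V : Ty, Var Δ V → K.Hom X (K.ty b V)) → K.Hom X (K.ty b U)
  | [], _, m, _ => m
  | T :: Δ, U, m, a =>
      K.appl (applVars Δ (U := Ty.arr T U) m (fun V y => a V y.succ)) (a T Var.zero)

/-- `f` with `k` dummy arguments of type `b` abstracted. -/
def dummies {X : K.Obj} (f : K.Hom X b) : (k : ℕ) → K.Hom X (K.ty b (natPow k))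
  | 0 => f
  | k + 1 => K.curry (K.comp (K.snd b X) (dummies f k))

/-- The `i`-th projection on `k` arguments, curried: `λ x₀ … xₖ₋₁. xᵢ`. -/
def curriedProj : (k : ℕ) → Fin k → K.Hom K.one (K.ty b (natPow k))
  | 0, i => i.elim0
  | k + 1, i =>
      Fin.cases (motive := fun _ => K.Hom K.one (K.ty b (natPow (k + 1))))
        (K.curry (K.dummies b (K.fst b K.one) k))
        (fun j => K.curry (K.comp (K.snd b K.one) (curriedProj k j))) i

end CartClosed

/-- A model of PCF: a cartesian closed category with a fixpoint operator, distinguished points `⊥`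
and interpretations of the base type and of the constants. -/
structure PCFModel extends CartClosed.{v, u} where
  bot : (A : Obj) → Hom one A
  fixpt : {A : Obj} → Hom A A → Hom one A
  fixpt_comp : ∀ {A : Obj} (f : Hom A A), comp (fixpt f) f = fixpt f
  nat : Obj
  num : ℕ → Hom one nat
  case : (k : ℕ) → Hom nat (toCartClosed.ty nat (natPow k))

namespace PCFModel

variable (M : PCFModel.{v, u})

abbrev tyObj (T : Ty) : M.Obj := M.toCartClosed.ty M.nat T

abbrev ctxObj (Γ : List Ty) : M.Obj := M.toCartClosed.ctx M.nat Γ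

/-- The recursion combinator: `fix ⟦F : (A ⇒ A) ⇒ A ⊢ λ f. f (F f)⟧`. -/
def recursor (A : M.Obj) : M.Hom M.one (M.exp (M.exp A A) A) :=
  M.fixpt (M.curry (M.appl (M.fst (M.exp A A) (M.exp (M.exp A A) A))
    (M.appl (M.snd (M.exp A A) (M.exp (M.exp A A) A))
      (M.fst (M.exp A A) (M.exp (M.exp A A) A)))))

/-- The interpretation `⟦Γ ⊢ M : T⟧` of terms. -/
def interp : {Γ : List Ty} → {T : Ty} → Tm Γ T → M.Hom (M.ctxObj Γ) (M.tyObj T)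
  | _, _, .var x => M.lookup M.nat x
  | _, _, .lam P => M.curry (interp P)
  | _, _, .app P Q => M.appl (interp P) (interp Q)
  | Γ, _, .fix T => M.comp (M.toOne (M.ctxObj Γ)) (M.recursor (M.tyObj T))
  | Γ, _, .omega => M.comp (M.toOne (M.ctxObj Γ)) (M.bot M.nat)
  | Γ, _, .num n => M.comp (M.toOne (M.ctxObj Γ)) (M.num n)
  | Γ, _, .case k => M.curry (M.comp (M.fst M.nat (M.ctxObj Γ)) (M.case k))

/-- `iter f k` is `f^k ∘ ⊥`. -/
def iter {A : M.Obj} (f : M.Hom A A) : ℕ → M.Hom M.one A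
  | 0 => M.bot A
  | k + 1 => M.comp (iter f k) f

/-- The name `⌜f⌝ : 1 → (A ⇒ B)` of `f : A → B`. -/
def name {A B : M.Obj} (f : M.Hom A B) : M.Hom M.one (M.exp A B) :=
  M.curry (M.comp (M.fst A M.one) f)

/-- The intrinsic preorder on points. -/
def PointLE {A : M.Obj} (f g : M.Hom M.one A) : Prop :=
  ∀ (α : M.Hom A M.nat) (n : ℕ), M.comp f α = M.num n → M.comp g α = M.num n

/-- The intrinsic preorder on arbitrary homsets, via names. -/
def IntrinsicLE {A B : M.Obj} (f g : M.Hom A B) : Prop := M.PointLE (M.name f) (M.name g)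

/-- Recursion is observed through its finite approximations, and `⊥` is observationally least. -/
structure Observable : Prop where
  fixpt_obs : ∀ {A : M.Obj} (f : M.Hom A A) (g : M.Hom A M.nat) (n : ℕ),
    M.comp (M.fixpt f) g = M.num n ↔ ∃ k : ℕ, M.comp (M.iter f k) g = M.num n
  bot_obs : ∀ {A B : M.Obj} (f : M.Hom A B), M.IntrinsicLE (M.comp (M.toOne A) (M.bot B)) f

end PCFModel

/-- A poset-enriched model of PCF: the underlying category is a rational cartesian closed category,
i.e. homsets are posets with least elements `⊥`, the cartesian closed structure is monotone, and
the fixpoint of `f` is the least upper bound of the chain `f^k ∘ ⊥`, which composition preserves. -/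
structure OrderedPCFModel extends PCFModel.{v, u} where
  order : (A B : Obj) → PartialOrder (Hom A B)
  comp_mono : ∀ {A B D : Obj} {f f' : Hom A B} {g g' : Hom B D},
    (order A B).le f f' → (order B D).le g g' → (order A D).le (comp f g) (comp f' g')
  pair_mono : ∀ {X A B : Obj} {f f' : Hom X A} {g g' : Hom X B},
    (order X A).le f f' → (order X B).le g g' → (order X (prod A B)).le (pair f g) (pair f' g')
  curry_mono : ∀ {X A B : Obj} {f f' : Hom (prod A X) B},
    (order (prod A X) B).le f f' → (order X (exp A B)).le (curry f) (curry f')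
  bot_le : ∀ {A B : Obj} (f : Hom A B), (order A B).le (comp (toOne A) (bot B)) f
  fixpt_isLUB : ∀ {A B : Obj} (f : Hom A A) (g : Hom A B),
    @IsLUB _ (order one B).toLE
      (Set.range fun k : ℕ => comp (toPCFModel.iter f k) g) (comp (fixpt f) g)

/-- Soundness: inequality of denotations implies the observational preorder. -/
def OrderedPCFModel.Sound (M : OrderedPCFModel.{v, u}) : Prop :=
  ∀ {Γ : List Ty} {T : Ty} (P Q : Tm Γ T),
    (M.order _ _).le (M.interp P) (M.interp Q) → ObsLE P Q

/-- Completeness: the observational preorder implies inequality of denotations. -/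
def OrderedPCFModel.Complete (M : OrderedPCFModel.{v, u}) : Prop :=
  ∀ {Γ : List Ty} {T : Ty} (P Q : Tm Γ T),
    ObsLE P Q → (M.order _ _).le (M.interp P) (M.interp Q)

def OrderedPCFModel.FullyAbstract (M : OrderedPCFModel.{v, u}) : Prop :=
  M.Sound ∧ M.Complete

/-! ### The quotient of a model by its intrinsic preorder -/

namespace CartClosed

variable (K : CartClosed.{v, u})

lemma hom_ext {X A B : K.Obj} {h k : K.Hom X (K.prod A B)}
    (h1 : K.comp h (K.fst A B) = K.comp k (K.fst A B))
    (h2 : K.comp h (K.snd A B) = K.comp k (K.snd A B)) : h = k := by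
  rw [← K.pair_eta h, ← K.pair_eta k, h1, h2]

lemma comp_pair {X Y A B : K.Obj} (h : K.Hom X Y) (f : K.Hom Y A) (g : K.Hom Y B) :
    K.comp h (K.pair f g) = K.pair (K.comp h f) (K.comp h g) := by
  apply K.hom_ext <;> simp [K.assoc, K.pair_fst, K.pair_snd]

lemma comp_pair_assoc {X Y A B D : K.Obj} (h : K.Hom X Y) (f : K.Hom Y A) (g : K.Hom Y B)
    (k : K.Hom (K.prod A B) D) :
    K.comp h (K.comp (K.pair f g) k) = K.comp (K.pair (K.comp h f) (K.comp h g)) k := by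
  rw [← K.assoc, K.comp_pair]

lemma pair_fst_assoc {X A B D : K.Obj} (f : K.Hom X A) (g : K.Hom X B) (k : K.Hom A D) :
    K.comp (K.pair f g) (K.comp (K.fst A B) k) = K.comp f k := by
  rw [← K.assoc, K.pair_fst]

lemma pair_snd_assoc {X A B D : K.Obj} (f : K.Hom X A) (g : K.Hom X B) (k : K.Hom B D) :
    K.comp (K.pair f g) (K.comp (K.snd A B) k) = K.comp g k := by
  rw [← K.assoc, K.pair_snd]

lemma pair_curry_ev {Y X A B : K.Obj} (a : K.Hom Y A) (x : K.Hom Y X)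
    (f : K.Hom (K.prod A X) B) :
    K.comp (K.pair a (K.comp x (K.curry f))) (K.ev A B) = K.comp (K.pair a x) f := by
  conv_rhs => rw [← K.curry_ev f]
  rw [K.comp_pair_assoc, K.pair_fst, ← K.assoc, K.pair_snd]

lemma comp_curry {Y X A B : K.Obj} (x : K.Hom Y X) (f : K.Hom (K.prod A X) B) :
    K.comp x (K.curry f) = K.curry (K.comp (K.pair (K.fst A Y) (K.comp (K.snd A Y) x)) f) := by
  rw [← K.curry_eta (K.comp x (K.curry f)), ← K.assoc, K.pair_curry_ev]

end CartClosed

namespace PCFModel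

variable (M : PCFModel.{v, u})

lemma name_curry_ev {Y A B : M.Obj} (a : M.Hom Y A) (x : M.Hom Y M.one) (f : M.Hom A B) :
    M.comp (M.pair a (M.comp x (M.name f))) (M.ev A B) = M.comp a f := by
  rw [name, M.pair_curry_ev, M.pair_fst_assoc]

lemma IntrinsicLE.refl {A B : M.Obj} (f : M.Hom A B) : M.IntrinsicLE f f := fun _ _ h => h

lemma IntrinsicLE.trans {A B : M.Obj} {f g h : M.Hom A B} (h1 : M.IntrinsicLE f g)
    (h2 : M.IntrinsicLE g h) : M.IntrinsicLE f h := fun α n e => h2 α n (h1 α n e)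

variable {M}

/-- Any operation that acts on names by composition is monotone. -/
lemma IntrinsicLE.of_names {A B A' B' : M.Obj} {f g : M.Hom A B} {f' g' : M.Hom A' B'}
    (θ : M.Hom (M.exp A B) (M.exp A' B')) (hf : M.name f' = M.comp (M.name f) θ)
    (hg : M.name g' = M.comp (M.name g) θ) (h : M.IntrinsicLE f g) : M.IntrinsicLE f' g' := by
  intro α n
  rw [hf, hg, M.assoc, M.assoc]
  exact h _ n

lemma name_eq {A B A' B' : M.Obj} (f : M.Hom A B) (f' : M.Hom A' B')
    (k : M.Hom (M.prod A' (M.exp A B)) B')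
    (h : M.comp (M.pair (M.fst A' M.one) (M.comp (M.snd A' M.one) (M.name f))) k =
      M.comp (M.fst A' M.one) f') :
    M.name f' = M.comp (M.name f) (M.curry k) := by
  rw [M.comp_curry, h, name]

lemma IntrinsicLE.comp_right {A B D : M.Obj} {f f' : M.Hom A B} (g : M.Hom B D)
    (h : M.IntrinsicLE f f') : M.IntrinsicLE (M.comp f g) (M.comp f' g) := by
  have key : ∀ f : M.Hom A B,
      M.name (M.comp f g) = M.comp (M.name f) (M.curry (M.comp (M.ev A B) g)) := by
    intro f
    apply name_eq
    rw [← M.assoc, M.name_curry_ev, M.assoc]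
  exact h.of_names _ (key f) (key f')

lemma IntrinsicLE.comp_left {A B D : M.Obj} (f : M.Hom A B) {g g' : M.Hom B D}
    (h : M.IntrinsicLE g g') : M.IntrinsicLE (M.comp f g) (M.comp f g') := by
  have key : ∀ g : M.Hom B D, M.name (M.comp f g) = M.comp (M.name g)
      (M.curry (M.appl (M.snd A (M.exp B D)) (M.comp (M.fst A (M.exp B D)) f))) := by
    intro g
    apply name_eq
    rw [CartClosed.appl, M.comp_pair_assoc, M.pair_fst_assoc, M.pair_snd, M.name_curry_ev, M.assoc]
  exact h.of_names _ (key g) (key g')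

lemma IntrinsicLE.comp {A B D : M.Obj} {f f' : M.Hom A B} {g g' : M.Hom B D}
    (h : M.IntrinsicLE f f') (h' : M.IntrinsicLE g g') :
    M.IntrinsicLE (M.comp f g) (M.comp f' g') :=
  (h.comp_right g).trans _ (h'.comp_left f')

lemma IntrinsicLE.pair {X A B : M.Obj} {f f' : M.Hom X A} {g g' : M.Hom X B}
    (h : M.IntrinsicLE f f') (h' : M.IntrinsicLE g g') :
    M.IntrinsicLE (M.pair f g) (M.pair f' g') := by
  have key1 : ∀ f : M.Hom X A, M.name (M.pair f g) = M.comp (M.name f)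
      (M.curry (M.pair (M.ev X A) (M.comp (M.fst X (M.exp X A)) g))) := by
    intro f
    apply name_eq
    rw [M.comp_pair, M.name_curry_ev, M.pair_fst_assoc, M.comp_pair]
  have key2 : ∀ g : M.Hom X B, M.name (M.pair f' g) = M.comp (M.name g)
      (M.curry (M.pair (M.comp (M.fst X (M.exp X B)) f') (M.ev X B))) := by
    intro g
    apply name_eq
    rw [M.comp_pair, M.name_curry_ev, M.pair_fst_assoc, M.comp_pair]
  exact (h.of_names _ (key1 f) (key1 f')).trans _ (h'.of_names _ (key2 g) (key2 g'))

lemma IntrinsicLE.curry {X A B : M.Obj} {f f' : M.Hom (M.prod A X) B}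
    (h : M.IntrinsicLE f f') : M.IntrinsicLE (M.curry f) (M.curry f') := by
  have key : ∀ f : M.Hom (M.prod A X) B, M.name (M.curry f) = M.comp (M.name f)
      (M.curry (M.curry (M.appl
        (M.comp (M.snd A (M.prod X (M.exp (M.prod A X) B))) (M.snd X (M.exp (M.prod A X) B)))
        (M.pair (M.fst A (M.prod X (M.exp (M.prod A X) B)))
          (M.comp (M.snd A (M.prod X (M.exp (M.prod A X) B)))
            (M.fst X (M.exp (M.prod A X) B))))))) := by
    intro f
    apply name_eq
    rw [M.comp_curry, M.comp_curry]
    congr 1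
    simp only [CartClosed.appl, M.comp_pair_assoc, M.comp_pair, M.pair_fst, M.pair_snd,
      M.pair_snd_assoc]
    rw [← M.assoc, M.name_curry_ev]
  exact h.of_names _ (key f) (key f')

/-- On points the two descriptions of the intrinsic preorder agree. -/
lemma intrinsicLE_iff_pointLE {A : M.Obj} {f g : M.Hom M.one A} :
    M.IntrinsicLE f g ↔ M.PointLE f g := by
  constructor
  · intro h α n e
    have key : ∀ f : M.Hom M.one A, M.comp (M.name f)
        (M.comp (M.pair (M.toOne _) (M.id _)) (M.comp (M.ev M.one A) α)) = M.comp f α := by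
      intro f
      rw [M.comp_pair_assoc, M.comp_id, ← M.assoc, ← M.id_comp (M.name f), M.id_comp (M.name f)]
      have : M.pair (M.comp (M.name f) (M.toOne _)) (M.name f) =
          M.pair (M.id M.one) (M.comp (M.id M.one) (M.name f)) := by
        rw [M.id_comp, M.toOne_unique (M.comp (M.name f) (M.toOne _)), ← M.toOne_unique (M.id _)]
      rw [this, M.name_curry_ev, M.id_comp]
    have := h (M.comp (M.pair (M.toOne _) (M.id _)) (M.comp (M.ev M.one A) α)) n
    rw [key, key] at this
    exact this e
  · intro h α n
    have key : ∀ f : M.Hom M.one A, M.name f = M.comp f (M.curry (M.snd M.one A)) := by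
      intro f
      rw [M.comp_curry, M.pair_snd, name,
        M.toOne_unique (M.fst M.one M.one), M.toOne_unique (M.snd M.one M.one)]
    rw [key, key, M.assoc, M.assoc]
    exact h _ n

lemma IntrinsicLE.iter {A : M.Obj} {f f' : M.Hom A A} (h : M.IntrinsicLE f f') (k : ℕ) :
    M.IntrinsicLE (M.iter f k) (M.iter f' k) := by
  induction k with
  | zero => exact IntrinsicLE.refl M _
  | succ k ih => exact ih.comp h

lemma IntrinsicLE.fixpt (hM : M.Observable) {A : M.Obj} {f f' : M.Hom A A}
    (h : M.IntrinsicLE f f') : M.IntrinsicLE (M.fixpt f) (M.fixpt f') := by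
  rw [intrinsicLE_iff_pointLE]
  intro α n e
  obtain ⟨k, hk⟩ := (hM.fixpt_obs f α n).1 e
  exact (hM.fixpt_obs f' α n).2 ⟨k, intrinsicLE_iff_pointLE.1 (h.iter k) α n hk⟩

variable (M)

/-- Homsets with the intrinsic preorder. -/
@[reducible] def intrinsicPreorder (A B : M.Obj) : Preorder (M.Hom A B) where
  le := M.IntrinsicLE
  le_refl := IntrinsicLE.refl M
  le_trans _ _ _ := IntrinsicLE.trans M

/-- The homset `M(A, B)/≲`, the poset reflection of `M(A, B)` under the intrinsic preorder. -/
def QHom (A B : M.Obj) : Type v :=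
  letI := M.intrinsicPreorder A B
  Antisymmetrization (M.Hom A B) (· ≤ ·)

@[reducible] def qhomOrder (A B : M.Obj) : PartialOrder (M.QHom A B) :=
  @instPartialOrderAntisymmetrization (M.Hom A B) (M.intrinsicPreorder A B)

/-- The quotient map on homsets. -/
def toQ {A B : M.Obj} (f : M.Hom A B) : M.QHom A B :=
  letI := M.intrinsicPreorder A B
  toAntisymmetrization (· ≤ ·) f

variable {M}

lemma toQ_le {A B : M.Obj} {f g : M.Hom A B} :
    (M.qhomOrder A B).le (M.toQ f) (M.toQ g) ↔ M.IntrinsicLE f g := Iff.rfl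

lemma toQ_eq {A B : M.Obj} {f g : M.Hom A B} (h : M.IntrinsicLE f g) (h' : M.IntrinsicLE g f) :
    M.toQ f = M.toQ g :=
  (M.qhomOrder A B).le_antisymm _ _ h h'

lemma QHom.ind {A B : M.Obj} {P : M.QHom A B → Prop} (h : ∀ f : M.Hom A B, P (M.toQ f))
    (q : M.QHom A B) : P q := Quotient.ind h q

def QHom.map {A B A' B' : M.Obj} (F : M.Hom A B → M.Hom A' B')
    (hF : ∀ f f' : M.Hom A B, M.IntrinsicLE f f' → M.IntrinsicLE (F f) (F f')) :
    M.QHom A B → M.QHom A' B' :=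
  Quotient.lift (fun f => M.toQ (F f)) fun f f' h => toQ_eq (hF f f' h.1) (hF f' f h.2)

def QHom.map₂ {A B A' B' A'' B'' : M.Obj} (F : M.Hom A B → M.Hom A' B' → M.Hom A'' B'')
    (hF : ∀ f f' g g', M.IntrinsicLE f f' → M.IntrinsicLE g g' →
      M.IntrinsicLE (F f g) (F f' g')) :
    M.QHom A B → M.QHom A' B' → M.QHom A'' B'' :=
  Quotient.lift₂ (fun f g => M.toQ (F f g))
    fun f g f' g' h h' => toQ_eq (hF f f' g g' h.1 h'.1) (hF f' f g' g h.2 h'.2)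

variable (M)

/-- The cartesian closed category `M/≲`: same objects as `M`, homsets the poset reflections of those
of `M`, all structure induced from `M`. -/
@[reducible] def quotientCartClosed : CartClosed.{v, u} where
  Obj := M.Obj
  Hom := M.QHom
  id A := M.toQ (M.id A)
  comp := QHom.map₂ M.comp fun _ _ _ _ h h' => h.comp h'
  id_comp := by
    intro A B; refine QHom.ind fun f => ?_
    exact congrArg M.toQ (M.id_comp f)
  comp_id := by
    intro A B; refine QHom.ind fun f => ?_
    exact congrArg M.toQ (M.comp_id f)
  assoc := by
    intro A B D E; refine QHom.ind fun f => QHom.ind fun g => QHom.ind fun h => ?_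
    exact congrArg M.toQ (M.assoc f g h)
  one := M.one
  toOne A := M.toQ (M.toOne A)
  toOne_unique := by
    intro A; refine QHom.ind fun f => ?_
    exact congrArg M.toQ (M.toOne_unique f)
  prod := M.prod
  fst A B := M.toQ (M.fst A B)
  snd A B := M.toQ (M.snd A B)
  pair := QHom.map₂ M.pair fun _ _ _ _ h h' => h.pair h'
  pair_fst := by
    intro X A B; refine QHom.ind fun f => QHom.ind fun g => ?_
    exact congrArg M.toQ (M.pair_fst f g)
  pair_snd := by
    intro X A B; refine QHom.ind fun f => QHom.ind fun g => ?_
    exact congrArg M.toQ (M.pair_snd f g)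
  pair_eta := by
    intro X A B; refine QHom.ind fun h => ?_
    exact congrArg M.toQ (M.pair_eta h)
  exp := M.exp
  ev A B := M.toQ (M.ev A B)
  curry := QHom.map M.curry fun _ _ h => h.curry
  curry_ev := by
    intro X A B; refine QHom.ind fun f => ?_
    exact congrArg M.toQ (M.curry_ev f)
  curry_eta := by
    intro X A B; refine QHom.ind fun g => ?_
    exact congrArg M.toQ (M.curry_eta g)

/-- `M/≲` with the constants and the fixpoint operator induced from `M`. -/
@[reducible] def quotientPCFModel (hM : M.Observable) : PCFModel.{v, u} where
  toCartClosed := M.quotientCartClosed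
  bot A := M.toQ (M.bot A)
  fixpt := QHom.map M.fixpt fun _ _ h => h.fixpt hM
  fixpt_comp := by
    intro A; refine QHom.ind fun f => ?_
    exact congrArg M.toQ (M.fixpt_comp f)
  nat := M.nat
  num n := M.toQ (M.num n)
  case k := M.toQ (M.case k)

lemma quotient_iter (hM : M.Observable) {A : M.Obj} (f : M.Hom A A) (k : ℕ) :
    (M.quotientPCFModel hM).iter (M.toQ f) k = M.toQ (M.iter f k) := by
  induction k with
  | zero => rfl
  | succ k ih =>
    change (M.quotientPCFModel hM).comp ((M.quotientPCFModel hM).iter (M.toQ f) k) (M.toQ f) = _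
    rw [ih]; rfl

/-- The poset-enriched model `M/≲`. -/
def quotientModel (hM : M.Observable) : OrderedPCFModel.{v, u} where
  toPCFModel := M.quotientPCFModel hM
  order := M.qhomOrder
  comp_mono := by
    intro A B D f f' g g'
    induction f using QHom.ind with | _ f
    induction f' using QHom.ind with | _ f'
    induction g using QHom.ind with | _ g
    induction g' using QHom.ind with | _ g'
    exact fun h h' => IntrinsicLE.comp h h'
  pair_mono := by
    intro X A B f f' g g'
    induction f using QHom.ind with | _ f
    induction f' using QHom.ind with | _ f'
    induction g using QHom.ind with | _ g
    induction g' using QHom.ind with | _ g'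
    exact fun h h' => IntrinsicLE.pair h h'
  curry_mono := by
    intro X A B f f'
    induction f using QHom.ind with | _ f
    induction f' using QHom.ind with | _ f'
    exact fun h => IntrinsicLE.curry h
  bot_le := by
    intro A B; refine QHom.ind fun f => ?_
    exact hM.bot_obs f
  fixpt_isLUB := by
    intro A B; refine QHom.ind fun f => QHom.ind fun g => ?_
    constructor
    · rintro _ ⟨k, rfl⟩
      simp only [quotient_iter]
      refine intrinsicLE_iff_pointLE.2 fun α n e => ?_
      rw [M.assoc] at e ⊢
      exact (hM.fixpt_obs f _ n).2 ⟨k, e⟩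
    · refine QHom.ind fun h hh => ?_
      refine intrinsicLE_iff_pointLE.2 fun α n e => ?_
      rw [M.assoc] at e
      obtain ⟨k, hk⟩ := (hM.fixpt_obs f _ n).1 e
      have := hh ⟨k, rfl⟩
      simp only [quotient_iter] at this
      refine intrinsicLE_iff_pointLE.1 this α n ?_
      rw [M.assoc]; exact hk

end PCFModel
end AxPCF

/-! ### Affine categories -/

namespace AxPCF

/-- An affine category: a symmetric monoidal closed category with finite products whose tensor unit
is terminal (all this is in the parameters), with a comonad `!` in co-Kleisli form and exponential
laws `!(A × B) ≅ !A ⊗ !B` and `!1 ≅ 1`, which make `!` a strong symmetric monoidal functor from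
`(×, 1)` to `(⊗, 1)`, compatibly with the comultiplication `!A ⟶ !!A`. -/
class AffineCategory (C : Type u) [Category.{v} C] [SemiCartesianMonoidalCategory C]
    [SymmetricCategory C] [MonoidalClosed C] [HasFiniteProducts C] where
  bang : C → C
  der : (A : C) → (bang A ⟶ A)
  prom : {A B : C} → (bang A ⟶ B) → (bang A ⟶ bang B)
  prom_prom : ∀ {A B D : C} (f : bang A ⟶ B) (g : bang B ⟶ D),
    prom f ≫ prom g = prom (prom f ≫ g)
  prom_der : ∀ {A B : C} (f : bang A ⟶ B), prom f ≫ der B = f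
  der_prom : ∀ {A B : C} (f : bang A ⟶ B), prom (der A) ≫ f = f
  seely : (A B : C) → (bang (A ⨯ B) ≅ bang A ⊗ bang B)
  seelyUnit : bang (𝟙_ C) ≅ 𝟙_ C
  seely_natural : ∀ {A A' B B' : C} (f : A ⟶ A') (g : B ⟶ B'),
    prom (der (A ⨯ B) ≫ prod.map f g) ≫ (seely A' B').hom =
      (seely A B).hom ≫ (prom (der A ≫ f) ⊗ₘ prom (der B ≫ g))
  seely_assoc : ∀ A B D : C,
    prom (der ((A ⨯ B) ⨯ D) ≫ (prod.associator A B D).hom) ≫ (seely A (B ⨯ D)).hom ≫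
        (bang A ◁ (seely B D).hom) =
      (seely (A ⨯ B) D).hom ≫ ((seely A B).hom ▷ bang D) ≫ (α_ (bang A) (bang B) (bang D)).hom
  seely_left_unit : ∀ A : C,
    (seely (𝟙_ C) A).hom ≫ (seelyUnit.hom ▷ bang A) ≫ (λ_ (bang A)).hom =
      prom (der (𝟙_ C ⨯ A) ≫ prod.snd)
  seely_right_unit : ∀ A : C,
    (seely A (𝟙_ C)).hom ≫ (bang A ◁ seelyUnit.hom) ≫ (ρ_ (bang A)).hom =
      prom (der (A ⨯ 𝟙_ C) ≫ prod.fst)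
  seely_symm : ∀ A B : C,
    prom (der (A ⨯ B) ≫ prod.lift prod.snd prod.fst) ≫ (seely B A).hom =
      (seely A B).hom ≫ (β_ (bang A) (bang B)).hom
  seely_comult : ∀ A B : C,
    prom (prod.lift (prom (der (A ⨯ B) ≫ prod.fst)) (prom (der (A ⨯ B) ≫ prod.snd))) ≫
        (seely (bang A) (bang B)).hom =
      (seely A B).hom ≫ (prom (𝟙 (bang A)) ⊗ₘ prom (𝟙 (bang B)))

open AffineCategory

section Affine

variable {C : Type u} [Category.{v} C] [SemiCartesianMonoidalCategory C]
    [SymmetricCategory C] [MonoidalClosed C] [HasFiniteProducts C] [AffineCategory C]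

/-- The action of `!` on morphisms. -/
def bangMap {A B : C} (f : A ⟶ B) : bang A ⟶ bang B := prom (der A ≫ f)

/-- The linear function space `A ⊸ B`. -/
abbrev lolli (A B : C) : C := (ihom A).obj B

/-- Contraction `!A ⟶ !A ⊗ !A`. -/
noncomputable def con (A : C) : bang A ⟶ bang A ⊗ bang A :=
  bangMap (prod.lift (𝟙 A) (𝟙 A)) ≫ (seely A A).hom

lemma prom_der_self (A : C) : prom (der A) = 𝟙 (bang A) := by
  have := der_prom (𝟙 (bang A)); rwa [Category.comp_id] at this

lemma prom_bangMap {A B D : C} (f : bang A ⟶ B) (g : B ⟶ D) :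
    prom f ≫ bangMap g = prom (f ≫ g) := by
  rw [bangMap, prom_prom, ← Category.assoc, prom_der]

lemma seely_prom {X A B : C} (f : bang A ⟶ X) {Y : C} (g : bang B ⟶ Y) :
    prom (prod.lift (bangMap prod.fst ≫ f) (bangMap prod.snd ≫ g)) ≫ (seely X Y).hom =
      (seely A B).hom ≫ (prom f ⊗ₘ prom g) := by
  have h : prod.lift (bangMap (prod.fst : A ⨯ B ⟶ A) ≫ f) (bangMap prod.snd ≫ g) =
      prod.lift (bangMap prod.fst) (bangMap prod.snd) ≫ prod.map f g := by
    rw [prod.lift_map]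
  rw [h, ← prom_bangMap, Category.assoc]
  have h1 := seely_natural f g
  have h2 := seely_comult A B
  change bangMap (prod.map f g) ≫ _ = _ ≫ (bangMap f ⊗ₘ bangMap g) at h1
  change prom (prod.lift (bangMap _) (bangMap _)) ≫ _ = _ at h2
  rw [h1, ← Category.assoc, h2, Category.assoc, tensorHom_comp_tensorHom, prom_bangMap,
    prom_bangMap, Category.id_comp, Category.id_comp]

lemma coKleisli_key {A X Y : C} (h : bang X ⟶ Y) :
    prom (prod.lift (der (A ⨯ X) ≫ prod.fst) (prom (der (A ⨯ X) ≫ prod.snd) ≫ h)) ≫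
      (seely A Y).hom ≫ (bang A ◁ der Y) = (seely A X).hom ≫ (bang A ◁ h) := by
  have := seely_prom (der A) h
  rw [bangMap, prom_der, prom_der_self] at this
  rw [← Category.assoc]
  change (prom (prod.lift _ (bangMap _ ≫ h)) ≫ _) ≫ _ = _
  rw [this, Category.assoc, id_tensorHom, ← whiskerLeft_comp, prom_der]

variable (C) in
/-- The co-Kleisli category `K_!(C)`, with products as in `C` and function space `!A ⊸ B`. -/
@[reducible] noncomputable def coKleisli : CartClosed.{v, u} where
  Obj := C
  Hom A B := bang A ⟶ B
  id A := der A
  comp f g := prom f ≫ g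
  id_comp f := der_prom f
  comp_id f := prom_der f
  assoc f g h := by rw [← Category.assoc, prom_prom]
  one := 𝟙_ C
  toOne A := toUnit (bang A)
  toOne_unique f := toUnit_unique _ _
  prod A B := A ⨯ B
  fst A B := der (A ⨯ B) ≫ prod.fst
  snd A B := der (A ⨯ B) ≫ prod.snd
  pair f g := prod.lift f g
  pair_fst f g := by rw [← Category.assoc, prom_der, prod.lift_fst]
  pair_snd f g := by rw [← Category.assoc, prom_der, prod.lift_snd]
  pair_eta h := by
    rw [← Category.assoc, prom_der, ← Category.assoc, prom_der]
    exact prod.hom_ext (prod.lift_fst _ _) (prod.lift_snd _ _)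
  exp A B := lolli (bang A) B
  ev A B := (seely A (lolli (bang A) B)).hom ≫ (bang A ◁ der (lolli (bang A) B)) ≫
    (ihom.ev (bang A)).app B
  curry {X A B} f := MonoidalClosed.curry ((seely A X).inv ≫ f)
  curry_ev {X A B} f := by
    rw [← Category.assoc, ← Category.assoc, Category.assoc (prom _), coKleisli_key,
      Category.assoc, ← MonoidalClosed.uncurry_eq, MonoidalClosed.uncurry_curry,
      Iso.hom_inv_id_assoc]
  curry_eta {X A B} g := by
    rw [← Category.assoc (seely A _).hom, ← Category.assoc (prom _), coKleisli_key,
      Category.assoc, Iso.inv_hom_id_assoc, ← MonoidalClosed.uncurry_eq,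
      MonoidalClosed.curry_uncurry]

end Affine

/-! ### Partiality, atomic and discrete objects -/

/-- Distinguished morphisms `⊥_A : 1 ⟶ A`, compatible with products. -/
class BottomMaps (C : Type u) [Category.{v} C] [SemiCartesianMonoidalCategory C]
    [HasFiniteProducts C] where
  bot : (A : C) → (𝟙_ C ⟶ A)
  bot_prod : ∀ A B : C, bot (A ⨯ B) = prod.lift (bot A) (bot B)

section Partiality

variable {C : Type u} [Category.{v} C] [SemiCartesianMonoidalCategory C] [HasFiniteProducts C]
    [BottomMaps C]

/-- `⊥_{A,B}`. It satisfies `⊥_{B,D} ∘ f = ⊥_{A,D}` because `1` is terminal. -/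
def botHom (A B : C) : A ⟶ B := toUnit A ≫ BottomMaps.bot B

def Strict {A B : C} (f : A ⟶ B) : Prop := BottomMaps.bot A ≫ f = BottomMaps.bot B

def Total {A B : C} (f : A ⟶ B) : Prop := Strict f ∧ f ≠ botHom A B

/-- The canonical map `∑ᵢ C_s(Aᵢ, B) ⟶ C_s(∏ᵢ Aᵢ, B)`, where the coproduct of pointed sets is
presented as the disjoint union of the sets of total maps with a base point `none` added. -/
noncomputable def sumToProd {n : ℕ} (A : Fin n → C) (B : C) :
    Option (Σ i : Fin n, {f : A i ⟶ B // Total f}) → (∏ᶜ A ⟶ B)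
  | none => botHom _ B
  | some p => Pi.π A p.1 ≫ p.2.1

/-- `B` is `π`-atomic: the canonical maps `∑ᵢ C_s(Aᵢ, B) ⟶ C_s(∏ᵢ Aᵢ, B)` are bijections. -/
def PiAtomic (B : C) : Prop :=
  ∀ {n : ℕ} (A : Fin n → C), Set.BijOn (sumToProd A B) Set.univ {h : ∏ᶜ A ⟶ B | Strict h}

/-- The canonical map `C_s(A, B) + C(1, B) ⟶ C(A, B)`; the coproduct of pointed sets is presented as
the disjoint union of the sets of elements other than the base points, with a base point added. -/
def strictOrConst (A B : C) :
    Option ({f : A ⟶ B // Total f} ⊕ {x : 𝟙_ C ⟶ B // x ≠ BottomMaps.bot B}) → (A ⟶ B)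
  | none => botHom A B
  | some (Sum.inl f) => f.1
  | some (Sum.inr x) => toUnit A ≫ x.1

/-- `B` is discrete: every morphism into `B` is, uniquely, either strict or constant. -/
def Discrete (B : C) : Prop := ∀ A : C, Function.Bijective (strictOrConst A B)

end Partiality

/-! ### Standard datatypes and sequential categories -/

/-- A class of well-opened objects, an exponential ideal closed under finite products, and standard
datatypes `X̃_⋆` for all sets `X`. Let `T` be the class of well-opened `π`-atomic objects whose
identity is total. The total maps between objects of `T` form a category, and the functor
`C(1, -)` from it to pointed sets has a left adjoint `X_⋆ ↦ X̃_⋆` whose unit is an isomorphism;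
this is stated through universal arrows: `x ↦ x̄` (and `⋆ ↦ ⊥`) is the unit. -/
class StandardDatatypes (C : Type u) [Category.{v} C] [SemiCartesianMonoidalCategory C]
    [MonoidalClosed C] [HasFiniteProducts C] [BottomMaps C] where
  wellOpened : C → Prop
  wellOpened_lolli : ∀ A B : C, wellOpened B → wellOpened (lolli A B)
  wellOpened_one : wellOpened (𝟙_ C)
  wellOpened_prod : ∀ A B : C, wellOpened A → wellOpened B → wellOpened (A ⨯ B)
  total_comp : ∀ {A B D : C}, (wellOpened A ∧ PiAtomic A ∧ Total (𝟙 A)) →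
    (wellOpened B ∧ PiAtomic B ∧ Total (𝟙 B)) → (wellOpened D ∧ PiAtomic D ∧ Total (𝟙 D)) →
    ∀ (f : A ⟶ B) (g : B ⟶ D), Total f → Total g → Total (f ≫ g)
  datatype : Type v → C
  datatype_mem : ∀ X : Type v, wellOpened (datatype X) ∧ PiAtomic (datatype X) ∧
    Total (𝟙 (datatype X))
  point : {X : Type v} → X → (𝟙_ C ⟶ datatype X)
  point_bijective : ∀ X : Type v, Function.Bijective
    (fun o : Option X => o.elim (BottomMaps.bot (datatype X)) point)
  existsUnique_total : ∀ {X : Type v} {A : C}, (wellOpened A ∧ PiAtomic A ∧ Total (𝟙 A)) →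
    ∀ f : X → (𝟙_ C ⟶ A), ∃! h : datatype X ⟶ A, Total h ∧ ∀ x : X, point x ≫ h = f x

open StandardDatatypes

section Datatypes

variable {C : Type u} [Category.{v} C] [SemiCartesianMonoidalCategory C]
    [MonoidalClosed C] [HasFiniteProducts C] [BottomMaps C] [StandardDatatypes C]

/-- Well-opened `π`-atomic objects whose identity is total. -/
abbrev AtomicWO (A : C) : Prop := wellOpened A ∧ PiAtomic A ∧ Total (𝟙 A)

/-- The total morphism `[f_x | x ∈ X]`. -/
noncomputable def cases {X : Type v} {A : C} (hA : AtomicWO A) (f : X → (𝟙_ C ⟶ A)) :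
    datatype X ⟶ A :=
  (existsUnique_total hA f).choose

lemma point_cases {X : Type v} {A : C} (hA : AtomicWO A) (f : X → (𝟙_ C ⟶ A)) (x : X) :
    point x ≫ cases hA f = f x :=
  (existsUnique_total hA f).choose_spec.1.2 x

lemma point_ne_bot {X : Type v} (x : X) :
    (point x : 𝟙_ C ⟶ datatype X) ≠ BottomMaps.bot (datatype X) := by
  intro h
  have := (point_bijective (C := C) X).1 (a₁ := some x) (a₂ := none) h
  simp at this

end Datatypes

section Sequential

variable {C : Type u} [Category.{v} C] [SemiCartesianMonoidalCategory C]
    [SymmetricCategory C] [MonoidalClosed C] [HasFiniteProducts C] [AffineCategory C]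

/-- The canonical map `C(A, !A ⊸ B) ⟶ C(!A, B)`: uncurry, dereliction on the head copy of `A`,
contraction. (Contraction is cocommutative, so the order of the tensor factors is immaterial.) -/
noncomputable def headOccurrence {A B : C} (f : A ⟶ lolli (bang A) B) : bang A ⟶ B :=
  con A ≫ (bang A ◁ der A) ≫ MonoidalClosed.uncurry f

/-- The canonical map `C(!E, A) × C(B, !E ⊸ D) ⟶ C(A ⊸ B, !E ⊸ D)`: the pair `(g, h)` is sent to
`g ⊸ h : A ⊸ B ⟶ !E ⊸ (!E ⊸ D)`, followed by uncurrying to `!E ⊗ !E ⊸ D` and contraction. -/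
noncomputable def linearExt {A B D E : C} (g : bang E ⟶ A) (h : B ⟶ lolli (bang E) D) :
    lolli A B ⟶ lolli (bang E) D :=
  MonoidalClosed.curry ((con E ▷ lolli A B) ≫ (α_ (bang E) (bang E) (lolli A B)).hom ≫
    (bang E ◁ ((g ▷ lolli A B) ≫ (ihom.ev A).app B)) ≫ MonoidalClosed.uncurry h)

end Sequential

/-- Sequential categories. -/
class SequentialCategory (C : Type u) [Category.{v} C] [SemiCartesianMonoidalCategory C]
    [SymmetricCategory C] [MonoidalClosed C] [HasFiniteProducts C] [AffineCategory C]
    [BottomMaps C] [StandardDatatypes C] : Prop where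
  datatype_discrete : ∀ X : Type v, Discrete (datatype X : C)
  datatype_piAtomic : ∀ X : Type v, PiAtomic (datatype X : C)
  piAtomic_lolli : ∀ A B : C, PiAtomic B → PiAtomic (lolli A B)
  /-- Uniformity of threads. -/
  uniformity : ∀ {A B : C}, wellOpened A → wellOpened B →
    ∀ f : bang A ⟶ bang B, prom (f ≫ der B) = f
  /-- Linearization of head occurrence. -/
  head_linearization : ∀ {A B : C}, wellOpened A → wellOpened B →
    Set.BijOn (headOccurrence : (A ⟶ lolli (bang A) B) → (bang A ⟶ B))
      {f | Strict f} {f | Strict f}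
  /-- Linear function extensionality. -/
  linear_extensionality : ∀ {A B D E : C},
    Discrete B → wellOpened B → PiAtomic B → Discrete D → wellOpened D → PiAtomic D →
    Set.BijOn (fun p : (bang E ⟶ A) × (B ⟶ lolli (bang E) D) => linearExt p.1 p.2)
      {p | Total p.2} {k : lolli A B ⟶ lolli (bang E) D | Total k}

/-! ### Normed sequential categories -/

/-- Enrichment of an affine category with `⊥`-maps and standard datatypes over algebraic cpo's: the
homsets are algebraic directed-complete posets with least elements `⊥`, all operations of the affine
structure on homsets are Scott continuous, and the points of standard datatypes form flat domains.-/
class CpoEnriched (C : Type u) [Category.{v} C] [SemiCartesianMonoidalCategory C]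
    [SymmetricCategory C] [MonoidalClosed C] [HasFiniteProducts C] [AffineCategory C]
    [BottomMaps C] [StandardDatatypes C] where
  homOrder : (A B : C) → PartialOrder (A ⟶ B)
  exists_lub : ∀ {A B : C} (s : Set (A ⟶ B)), s.Nonempty → DirectedOn (· ≤ ·) s →
    ∃ f, IsLUB s f
  algebraic : ∀ {A B : C} (f : A ⟶ B),
    {c : A ⟶ B | IsCompactElement c ∧ c ≤ f}.Nonempty ∧
    DirectedOn (· ≤ ·) {c : A ⟶ B | IsCompactElement c ∧ c ≤ f} ∧
    IsLUB {c : A ⟶ B | IsCompactElement c ∧ c ≤ f} f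
  bot_le : ∀ {A B : C} (f : A ⟶ B), botHom A B ≤ f
  comp_left : ∀ {A B D : C} (f : A ⟶ B), ScottContinuous (fun g : B ⟶ D => f ≫ g)
  comp_right : ∀ {A B D : C} (g : B ⟶ D), ScottContinuous (fun f : A ⟶ B => f ≫ g)
  whiskerLeft : ∀ (X : C) {A B : C}, ScottContinuous (fun f : A ⟶ B => X ◁ f)
  whiskerRight : ∀ {A B : C} (X : C), ScottContinuous (fun f : A ⟶ B => f ▷ X)
  lift_left : ∀ {X A B : C} (f : X ⟶ A), ScottContinuous (fun g : X ⟶ B => prod.lift f g)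
  lift_right : ∀ {X A B : C} (g : X ⟶ B), ScottContinuous (fun f : X ⟶ A => prod.lift f g)
  curry : ∀ {A B D : C},
    ScottContinuous (MonoidalClosed.curry : (A ⊗ B ⟶ D) → (B ⟶ (ihom A).obj D))
  prom : ∀ {A B : C}, ScottContinuous (prom : (bang A ⟶ B) → (bang A ⟶ bang B))
  flat : ∀ {X : Type v} (f g : 𝟙_ C ⟶ datatype X),
    f ≤ g ↔ f = BottomMaps.bot (datatype X) ∨ f = g

attribute [reducible, instance] CpoEnriched.homOrder

section Model

set_option linter.unusedSectionVars false

variable {C : Type u} [Category.{v} C] [SemiCartesianMonoidalCategory C]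
    [SymmetricCategory C] [MonoidalClosed C] [HasFiniteProducts C] [AffineCategory C]
    [BottomMaps C] [StandardDatatypes C]

variable (C) in
/-- The interpretation of the base type. -/
abbrev natObj : C := datatype (ULift.{v} ℕ)

/-- The morphism `1 ⟶ A` of `C` corresponding to a morphism `1 ⟶ A` of `K_!(C)`. -/
def toPoint {A : C} (f : bang (𝟙_ C) ⟶ A) : 𝟙_ C ⟶ A := seelyUnit.inv ≫ f

variable [SequentialCategory C]

lemma exists_point_lolli {A B : C} (x : 𝟙_ C ⟶ B) (hx : x ≠ BottomMaps.bot B) :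
    ∃ y : 𝟙_ C ⟶ lolli A B, y ≠ BottomMaps.bot (lolli A B) := by
  by_contra! h
  have hs : ∀ f g : A ⟶ B, f = g := by
    intro f g
    have e : MonoidalClosed.curry ((ρ_ A).hom ≫ f) = MonoidalClosed.curry ((ρ_ A).hom ≫ g) := by
      rw [h (MonoidalClosed.curry _), h (MonoidalClosed.curry ((ρ_ A).hom ≫ g))]
    have := MonoidalClosed.curry_injective e
    rwa [cancel_epi] at this
  apply hx
  have e := congrArg (fun k => BottomMaps.bot A ≫ k) (hs (toUnit A ≫ x) (botHom A B))
  simpa [botHom] using e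

lemma total_id_of_point {A : C} (x : 𝟙_ C ⟶ A) (hx : x ≠ BottomMaps.bot A) : Total (𝟙 A) := by
  refine ⟨Category.comp_id _, fun e => hx ?_⟩
  have := congrArg (fun k => x ≫ k) e
  simpa [botHom] using this

lemma atomicWO_natPow (k : ℕ) : AtomicWO ((coKleisli C).ty (natObj C) (natPow k)) := by
  have h : wellOpened ((coKleisli C).ty (natObj C) (natPow k)) ∧
      PiAtomic ((coKleisli C).ty (natObj C) (natPow k)) ∧
      ∃ x : 𝟙_ C ⟶ (coKleisli C).ty (natObj C) (natPow k), x ≠ BottomMaps.bot _ := by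
    induction k with
    | zero => exact ⟨(datatype_mem _).1, (datatype_mem _).2.1, point ⟨0⟩, point_ne_bot _⟩
    | succ k ih =>
      obtain ⟨h1, h2, x, hx⟩ := ih
      exact ⟨wellOpened_lolli _ _ h1, SequentialCategory.piAtomic_lolli _ _ h2,
        exists_point_lolli x hx⟩
  obtain ⟨h1, h2, x, hx⟩ := h
  exact ⟨h1, h2, total_id_of_point x hx⟩

lemma atomicWO_lolli_nat (A : C) : AtomicWO (lolli A (natObj C)) := by
  obtain ⟨x, hx⟩ := exists_point_lolli (A := A) (point (C := C) (ULift.up.{v} 0)) (point_ne_bot _)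
  exact ⟨wellOpened_lolli _ _ (datatype_mem _).1,
    SequentialCategory.piAtomic_lolli _ _ (datatype_mem _).2.1, total_id_of_point x hx⟩

/-- The morphism `Cᵢ⟨a₁, …, a_q; g_n⟩ : !⟦Γ⟧ ⟶ ⟦nat⟧`: the variable `x`, whose type is
`⋯ ⇒ nat` with one argument for each member of `Δ`, is applied to the `a_j`, and then a case
distinction with branches `g_n` is made on the (linearly used) result. In the notation of `C` it is
`con ; (con ; (der ; πᵢ) ⊗ ⟨a₁, …, a_q⟩† ; Ap) ⊗ id ; Λ⁻¹ [g_n | n ∈ ℕ]`, up to the canonical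
isomorphisms between curried and uncurried function spaces and the symmetry of `⊗`. -/
noncomputable def headCase {Γ Δ : List Ty} (x : Var Γ (arrows Δ Ty.nat))
    (a : ∀ V : Ty, Var Δ V → (bang ((coKleisli C).ctx (natObj C) Γ) ⟶
      (coKleisli C).ty (natObj C) V))
    (g : ℕ → (bang ((coKleisli C).ctx (natObj C) Γ) ⟶ natObj C)) :
    bang ((coKleisli C).ctx (natObj C) Γ) ⟶ natObj C :=
  con ((coKleisli C).ctx (natObj C) Γ) ≫
    (bang ((coKleisli C).ctx (natObj C) Γ) ◁
      ((coKleisli C).applVars (natObj C) Δ (U := Ty.nat)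
        ((coKleisli C).lookup (natObj C) x) a : _ ⟶ natObj C)) ≫
    MonoidalClosed.uncurry (cases (atomicWO_lolli_nat (bang ((coKleisli C).ctx (natObj C) Γ)))
      (fun n : ULift.{v} ℕ => MonoidalClosed.curry ((ρ_ _).hom ≫ g n.down)))

/-- The point `1 ⟶ ⟦Γ ⇒ U⟧` of `C` corresponding to a morphism `!⟦Γ⟧ ⟶ ⟦U⟧`. -/
noncomputable def closedPoint (Γ : List Ty) {U : Ty}
    (f : bang ((coKleisli C).ctx (natObj C) Γ) ⟶ (coKleisli C).ty (natObj C) U) :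
    𝟙_ C ⟶ (coKleisli C).ty (natObj C) (arrows Γ U) :=
  toPoint ((coKleisli C).close (natObj C) Γ f)

variable [CpoEnriched C]

/-- The chain `f^k ∘ ⊥` in `K_!(C)`. -/
def approx {A : C} (f : bang A ⟶ A) : ℕ → (bang (𝟙_ C) ⟶ A)
  | 0 => botHom _ A
  | k + 1 => prom (approx f k) ≫ f

lemma approx_le_succ {A : C} (f : bang A ⟶ A) (k : ℕ) : approx f k ≤ approx f (k + 1) := by
  induction k with
  | zero => exact CpoEnriched.bot_le _
  | succ k ih => exact (CpoEnriched.comp_right f).monotone (CpoEnriched.prom.monotone ih)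

lemma approx_directed {A : C} (f : bang A ⟶ A) : DirectedOn (· ≤ ·) (Set.range (approx f)) := by
  have hm : Monotone (approx f) := monotone_nat_of_le_succ (approx_le_succ f)
  rintro _ ⟨i, rfl⟩ _ ⟨j, rfl⟩
  exact ⟨_, ⟨max i j, rfl⟩, hm (le_max_left i j), hm (le_max_right i j)⟩

/-- The fixpoint operator of `K_!(C)`: the least upper bound of the chain `f^k ∘ ⊥`. -/
noncomputable def leastFix {A : C} (f : bang A ⟶ A) : bang (𝟙_ C) ⟶ A :=
  (CpoEnriched.exists_lub (Set.range (approx f)) (Set.range_nonempty _) (approx_directed f)).choose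

lemma leastFix_isLUB {A : C} (f : bang A ⟶ A) : IsLUB (Set.range (approx f)) (leastFix f) :=
  (CpoEnriched.exists_lub (Set.range (approx f)) (Set.range_nonempty _)
    (approx_directed f)).choose_spec

lemma leastFix_comp_isLUB {A B : C} (f : bang A ⟶ A) (g : bang A ⟶ B) :
    IsLUB (Set.range fun k => prom (approx f k) ≫ g) (prom (leastFix f) ≫ g) := by
  have h1 := CpoEnriched.prom (Set.range_nonempty _) (approx_directed f) (leastFix_isLUB f)
  have hd := (approx_directed f).mono_comp (rb := (· ≤ ·)) (g := prom) (fun _ _ h => CpoEnriched.prom.monotone h)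
  have h2 := CpoEnriched.comp_right g ((Set.range_nonempty _).image _) hd h1
  rwa [← Set.range_comp, ← Set.range_comp] at h2

lemma leastFix_unfold {A : C} (f : bang A ⟶ A) : prom (leastFix f) ≫ f = leastFix f := by
  refine (leastFix_comp_isLUB f f).unique ⟨?_, fun b hb => (leastFix_isLUB f).2 ?_⟩
  · rintro _ ⟨k, rfl⟩
    exact (leastFix_isLUB f).1 ⟨k + 1, rfl⟩
  · rintro _ ⟨k, rfl⟩
    exact (approx_le_succ f k).trans (hb ⟨k, rfl⟩)

variable (C) in
/-- `K_!(C)` as a model of PCF. -/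
@[reducible] noncomputable def coKleisliModel : PCFModel.{v, u} where
  toCartClosed := coKleisli C
  bot A := botHom (bang (𝟙_ C)) A
  fixpt := leastFix
  fixpt_comp := leastFix_unfold
  nat := natObj C
  num n := toUnit (bang (𝟙_ C)) ≫ point (ULift.up n)
  case k := der (natObj C) ≫ cases (atomicWO_natPow k) (fun i : ULift.{v} ℕ =>
    if h : i.down < k then toPoint ((coKleisli C).curriedProj (natObj C) k ⟨i.down, h⟩)
    else BottomMaps.bot _)

lemma coKleisli_flat {f g : bang (𝟙_ C) ⟶ natObj C} (h : f ≤ g) :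
    f = botHom _ _ ∨ f = g := by
  have h' := (CpoEnriched.comp_left (seelyUnit (C := C)).inv).monotone h
  rcases (CpoEnriched.flat _ _).1 h' with e | e
  · left
    have := congrArg (fun k => (seelyUnit (C := C)).hom ≫ k) e
    simp only [Iso.hom_inv_id_assoc] at this
    rw [this, botHom]
    congr 1
    exact toUnit_unique _ _
  · right
    exact (cancel_epi _).1 e

lemma coKleisli_num_ne_bot (n : ℕ) :
    toUnit (bang (𝟙_ C)) ≫ point (ULift.up n) ≠ botHom (bang (𝟙_ C)) (natObj C) := by
  intro h
  have := congrArg (fun k => (seelyUnit (C := C)).inv ≫ k) h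
  simp only [botHom, comp_toUnit_assoc, toUnit_unit, Category.id_comp] at this
  exact point_ne_bot _ this

lemma coKleisli_eq_num {f : bang (𝟙_ C) ⟶ natObj C} {n : ℕ}
    (h : toUnit (bang (𝟙_ C)) ≫ point (ULift.up n) ≤ f) :
    f = toUnit (bang (𝟙_ C)) ≫ point (ULift.up n) :=
  ((coKleisli_flat h).resolve_left (coKleisli_num_ne_bot n)).symm

variable (C) in
lemma coKleisli_observable : (coKleisliModel C).Observable where
  fixpt_obs {A} f g n := by
    have hit : ∀ k, (coKleisliModel C).iter f k = approx f k := by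
      intro k
      induction k with
      | zero => rfl
      | succ k ih => exact congrArg (fun x => prom x ≫ f) ih
    have hl := leastFix_comp_isLUB f g
    constructor
    · intro e
      by_contra! hk
      change prom (leastFix f) ≫ g = _ at e
      rw [e] at hl
      refine coKleisli_num_ne_bot (C := C) n (le_antisymm (hl.2 ?_) (CpoEnriched.bot_le _))
      rintro _ ⟨k, rfl⟩
      rcases coKleisli_flat (hl.1 ⟨k, rfl⟩) with e' | e'
      · exact e'.le
      · exact absurd (by rw [hit]; exact e') (hk k)
    · rintro ⟨k, hk⟩
      rw [hit] at hk
      exact coKleisli_eq_num (hk.symm.le.trans (hl.1 ⟨k, rfl⟩))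
  bot_obs {A B} f α n e := by
    have h : (coKleisliModel C).comp ((coKleisliModel C).toOne A) ((coKleisliModel C).bot B) ≤ f := by
      change prom (toUnit (bang A)) ≫ botHom _ _ ≤ f
      have : prom (toUnit (bang A)) ≫ botHom _ B = botHom (bang A) B := by simp [botHom]
      rw [this]
      exact CpoEnriched.bot_le f
    refine coKleisli_eq_num (le_trans e.symm.le ?_)
    refine (CpoEnriched.comp_right α).monotone (CpoEnriched.prom.monotone
      (CpoEnriched.curry.monotone ((CpoEnriched.comp_left _).monotone
        ((CpoEnriched.comp_left _).monotone h))))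

variable (C) in
/-- The poset-enriched model `K_!(C)/≲`. -/
noncomputable def coKleisliQuotient : OrderedPCFModel.{v, u} :=
  (coKleisliModel C).quotientModel (coKleisli_observable C)

end Model

/-- Normed sequential categories: sequential categories enriched over algebraic cpo's, with a norm
on compact morphisms such that, for each PCF type `⟦T⟧ = ⟦Γ ⇒ nat⟧` and compact
`f : 1 ⟶ ⟦T⟧`, if `f` is (the currying of) `Cᵢ⟨a₁, …, a_q; g_n⟩` then the `a_j` and the `g_n`,
regarded as points of PCF types, are compact of smaller norm, and almost all `g_n` are `⊥`. -/
class NormedSequentialCategory (C : Type u) [Category.{v} C] [SemiCartesianMonoidalCategory C]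
    [SymmetricCategory C] [MonoidalClosed C] [HasFiniteProducts C] [AffineCategory C]
    [BottomMaps C] [StandardDatatypes C] extends SequentialCategory C, CpoEnriched C where
  norm : {A B : C} → {f : A ⟶ B // IsCompactElement f} → ℕ
  norm_headCase : ∀ {Γ Δ : List Ty} (x : Var Γ (arrows Δ Ty.nat))
    (a : ∀ V : Ty, Var Δ V → (bang ((coKleisli C).ctx (natObj C) Γ) ⟶
      (coKleisli C).ty (natObj C) V))
    (g : ℕ → (bang ((coKleisli C).ctx (natObj C) Γ) ⟶ natObj C))
    (hf : IsCompactElement (closedPoint Γ (U := Ty.nat) (headCase x a g))),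
    (∀ (V : Ty) (y : Var Δ V), ∃ h : IsCompactElement (closedPoint Γ (a V y)),
      norm ⟨closedPoint Γ (a V y), h⟩ < norm ⟨closedPoint Γ (U := Ty.nat) (headCase x a g), hf⟩) ∧
    (∀ n : ℕ, ∃ h : IsCompactElement (closedPoint Γ (U := Ty.nat) (g n)),
      norm ⟨closedPoint Γ (U := Ty.nat) (g n), h⟩ <
        norm ⟨closedPoint Γ (U := Ty.nat) (headCase x a g), hf⟩) ∧
    {n : ℕ | g n ≠ botHom _ _}.Finite

end AxPCF

/-!
The quotient identifies morphisms that pass the same tests with numeral outcomes, so both directions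
compare tests in `K_!(C)` with program contexts.

Soundness rests on computational adequacy (`FlatBase.eval_iff`): a program evaluates to `n` iff it
denotes `n`. Plotkin's logical relation between points and closed terms (`Rel`) gives this for every
model whose base type is flat and whose fixpoints are observed through their approximations. As the
intrinsic preorder is a congruence, `⟦M⟧ ≲ ⟦N⟧` gives `⟦K[M]⟧ ≲ ⟦K[N]⟧` for every context `K`, and
adequacy turns this into the observational preorder.

Completeness rests on definability of compact elements (`definability`). A morphism
`f : !⟦Γ⟧ ⟶ nat` is strict or constant, as `nat` is discrete. If it is strict, linearization of head
occurrence presents it as a strict linear map `⟦Γ⟧ ⟶ (!⟦Γ⟧ ⊸ nat)`, which uses a single variable,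
since its codomain is `π`-atomic. The type of that variable is isomorphic to `!⟦Δ⟧ ⊸ nat`
(`uncurryVars`), so linear function extensionality and uniformity of threads split the map into
arguments for the variable and branches for the numeral it returns. Hence every `f` is `⊥`, a
numeral, or a `headCase` (`decomposition`). The parts of a compact `headCase` have smaller norm and
almost all branches are `⊥`, so by induction on the norm `f` is the denotation of a term
`case_k (x A₁ ⋯ A_q) G₀ ⋯ G_{k-1}` (`interp_headCase`). Both computations in `C` use two forms of
application that share a resource, `linAppl` and `headAppl`, which obey `headAppl_linearExt` because
contraction is coassociative.

Finally, a test that `⟦M⟧` passes can be taken to act on the closures of `M` and `N`. By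
algebraicity and flatness of the base type some compact approximation of it succeeds on `M`
(`exists_compact_test`); this is definable, hence yields a program context, which succeeds on `N` if
`M ⊑ N`; so does the given test, which lies above.
-/

namespace AxPCF

/-! ### Renaming and substitution -/

theorem Ren.lift_id {Γ : List Ty} (S : Ty) :
    Ren.lift (fun T (x : Var Γ T) => x) S = fun _ x => x := by
  funext T x
  cases x <;> rfl

theorem Tm.rename_id {Γ : List Ty} {T : Ty} (M : Tm Γ T) : M.rename (fun _ x => x) = M := by
  induction M with
  | lam M ih => simp [Tm.rename, Ren.lift_id, ih]
  | app M N ihM ihN => simp [Tm.rename, ihM, ihN]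
  | _ => rfl

theorem Ren.lift_comp {Γ Δ Θ : List Ty} (ρ : Ren Γ Δ) (ρ' : Ren Δ Θ) (S : Ty) :
    Ren.lift (fun _ x => ρ' _ (ρ _ x)) S = fun _ x => ρ'.lift S _ (ρ.lift S _ x) := by
  funext T x
  cases x <;> rfl

theorem Tm.rename_rename {Γ Δ Θ : List Ty} {T : Ty} (M : Tm Γ T) (ρ : Ren Γ Δ) (ρ' : Ren Δ Θ) :
    (M.rename ρ).rename ρ' = M.rename (fun _ x => ρ' _ (ρ _ x)) := by
  induction M generalizing Δ Θ with
  | lam M ih => simp [Tm.rename, Ren.lift_comp, ih]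
  | app M N ihM ihN => simp [Tm.rename, ihM, ihN]
  | _ => rfl

theorem Tm.subst_rename {Γ Δ Θ : List Ty} {T : Ty} (M : Tm Γ T) (ρ : Ren Γ Δ) (σ : Sub Δ Θ) :
    (M.rename ρ).subst σ = M.subst (fun _ x => σ _ (ρ _ x)) := by
  induction M generalizing Δ Θ with
  | lam M ih =>
    simp only [Tm.rename, Tm.subst, ih]
    congr 2
    funext T x
    cases x <;> rfl
  | app M N ihM ihN => simp [Tm.rename, Tm.subst, ihM, ihN]
  | _ => rfl

theorem Tm.rename_subst {Γ Δ Θ : List Ty} {T : Ty} (M : Tm Γ T) (σ : Sub Γ Δ) (ρ : Ren Δ Θ) :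
    (M.subst σ).rename ρ = M.subst (fun _ x => (σ _ x).rename ρ) := by
  induction M generalizing Δ Θ with
  | lam M ih =>
    simp only [Tm.rename, Tm.subst, ih]
    congr 2
    funext T x
    cases x with
    | zero => rfl
    | succ x => simp only [Sub.lift, Tm.weaken, Tm.rename_rename]; rfl
  | app M N ihM ihN => simp [Tm.rename, Tm.subst, ihM, ihN]
  | _ => rfl

theorem Tm.subst_subst {Γ Δ Θ : List Ty} {T : Ty} (M : Tm Γ T) (σ : Sub Γ Δ) (τ : Sub Δ Θ) :
    (M.subst σ).subst τ = M.subst (fun _ x => (σ _ x).subst τ) := by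
  induction M generalizing Δ Θ with
  | lam M ih =>
    simp only [Tm.subst, ih]
    congr 2
    funext T x
    cases x with
    | zero => rfl
    | succ x => simp only [Sub.lift, Tm.weaken, Tm.subst_rename, Tm.rename_subst]
  | app M N ihM ihN => simp [Tm.subst, ihM, ihN]
  | _ => rfl

theorem Tm.subst_var {Γ : List Ty} {T : Ty} (M : Tm Γ T) : M.subst (fun _ => Tm.var) = M := by
  induction M with
  | @lam Γ S T M ih =>
    have h : Sub.lift (fun _ => Tm.var : Sub Γ Γ) S = fun _ => Tm.var := by
      funext T x
      cases x <;> rfl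
    simp only [Tm.subst, h, ih]
  | app M N ihM ihN => simp [Tm.subst, ihM, ihN]
  | _ => rfl

/-- The substitution `σ` extended by a term for the most recent variable. -/
def Sub.cons {Γ Δ : List Ty} {S : Ty} (N : Tm Δ S) (σ : Sub Γ Δ) : Sub (S :: Γ) Δ
  | _, Var.zero => N
  | _, Var.succ x => σ _ x

theorem Tm.subst_lift_single {Γ Δ : List Ty} {S T : Ty} (M : Tm (S :: Γ) T) (σ : Sub Γ Δ)
    (N : Tm Δ S) : (M.subst (σ.lift S)).subst (Sub.single N) = M.subst (Sub.cons N σ) := by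
  rw [Tm.subst_subst]
  congr 1
  funext T x
  cases x with
  | zero => rfl
  | succ x =>
    simp only [Sub.lift, Tm.weaken, Tm.subst_rename, Sub.cons]
    exact Tm.subst_var _

/-- Every type is a function type into `nat`. -/
theorem Ty.exists_arrows (T : Ty) : ∃ Δ : List Ty, T = arrows Δ Ty.nat := by
  have key : ∀ (Δ : List Ty) (S U : Ty), arrows (Δ ++ [S]) U = Ty.arr S (arrows Δ U) := by
    intro Δ S
    induction Δ with
    | nil => exact fun _ => rfl
    | cons T Δ ih => exact fun U => ih _
  induction T with
  | nat => exact ⟨[], rfl⟩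
  | arr S T _ ih =>
    obtain ⟨Δ, rfl⟩ := ih
    exact ⟨Δ ++ [S], (key _ _ _).symm⟩

/-- `λ`-abstraction over the whole context. -/
def Tm.closure : (Γ : List Ty) → {U : Ty} → Tm Γ U → Tm [] (arrows Γ U)
  | [], _, M => M
  | _ :: Γ, _, M => Tm.closure Γ (.lam M)

/-- `λ`-abstraction over the whole scope of a context. -/
def Ctxt.closure {Γ : List Ty} {T : Ty} : (Δ : List Ty) → {U : Ty} → Ctxt Γ T Δ U →
    Ctxt Γ T [] (arrows Δ U)
  | [], _, K => K
  | _ :: Δ, _, K => Ctxt.closure Δ (.lam K)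

theorem Ctxt.plug_closure {Γ : List Ty} {T : Ty} (M : Tm Γ T) (Δ : List Ty) {U : Ty}
    (K : Ctxt Γ T Δ U) : (Ctxt.closure Δ K).plug M = Tm.closure Δ (K.plug M) := by
  induction Δ generalizing U with
  | nil => rfl
  | cons S Δ ih => exact ih _

/-- Application of a term of type `arrows Δ U` to one argument for each member of `Δ`. -/
def Tm.appVars {Γ : List Ty} : (Δ : List Ty) → {U : Ty} → Tm Γ (arrows Δ U) →
    (∀ V : Ty, Var Δ V → Tm Γ V) → Tm Γ U
  | [], _, M, _ => M
  | T :: Δ, U, M, A =>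
      .app (Tm.appVars Δ (U := Ty.arr T U) M (fun V y => A V y.succ)) (A T Var.zero)

/-! ### Calculation in cartesian closed categories -/

namespace CartClosed

variable (K : CartClosed.{v, u})

theorem toOne_eq_id : K.toOne K.one = K.id K.one := (K.toOne_unique _).symm

theorem comp_toOne {X Y : K.Obj} (f : K.Hom X Y) : K.comp f (K.toOne Y) = K.toOne X :=
  K.toOne_unique _

theorem comp_toOne_assoc {X Y Z : K.Obj} (f : K.Hom X Y) (g : K.Hom K.one Z) :
    K.comp f (K.comp (K.toOne Y) g) = K.comp (K.toOne X) g := by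
  rw [← K.assoc, K.comp_toOne]

theorem toOne_one_comp {Z : K.Obj} (g : K.Hom K.one Z) : K.comp (K.toOne K.one) g = g := by
  rw [toOne_eq_id, K.id_comp]

theorem comp_appl {X Y A B : K.Obj} (h : K.Hom X Y) (f : K.Hom Y (K.exp A B)) (a : K.Hom Y A) :
    K.comp h (K.appl f a) = K.appl (K.comp h f) (K.comp h a) := by
  rw [appl, appl, ← K.assoc, K.comp_pair]

theorem appl_comp_curry {X Y A B : K.Obj} (h : K.Hom X Y) (f : K.Hom (K.prod A Y) B)
    (a : K.Hom X A) : K.appl (K.comp h (K.curry f)) a = K.comp (K.pair a h) f :=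
  K.pair_curry_ev a h f

theorem appl_curry {X A B : K.Obj} (f : K.Hom (K.prod A X) B)
    (a : K.Hom X A) : K.appl (K.curry f) a = K.comp (K.pair a (K.id X)) f := by
  rw [← K.appl_comp_curry, K.id_comp]

theorem curry_appl_fst {X A B : K.Obj} (g : K.Hom X (K.exp A B)) :
    K.curry (K.appl (K.comp (K.snd A X) g) (K.fst A X)) = g :=
  K.curry_eta g

variable (b : K.Obj)

/-- The semantic counterpart of `appPow`. -/
def applPow {X : K.Obj} : (k : ℕ) → K.Hom X (K.ty b (natPow k)) → (Fin k → K.Hom X b) → K.Hom X b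
  | 0, m, _ => m
  | k + 1, m, q => applPow k (K.appl (A := b) (B := K.ty b (natPow k)) m (q 0)) (fun i => q i.succ)

theorem applPow_dummies {X Y : K.Obj} (h : K.Hom X Y) (f : K.Hom Y b) (k : ℕ)
    (q : Fin k → K.Hom X b) :
    K.applPow b k (K.comp h (K.dummies b f k)) q = K.comp h f := by
  induction k with
  | zero => rfl
  | succ k ih =>
    have e := K.appl_comp_curry h (K.comp (K.snd b Y) (K.dummies b f k)) (q 0)
    rw [K.pair_snd_assoc] at e
    exact (congrArg (fun m => K.applPow b k m fun i => q i.succ) e).trans (ih _)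

theorem applPow_curriedProj {X : K.Obj} (k : ℕ) (i : Fin k) (q : Fin k → K.Hom X b) :
    K.applPow b k (K.comp (K.toOne X) (K.curriedProj b k i)) q = q i := by
  induction k with
  | zero => exact i.elim0
  | succ k ih =>
    refine Fin.cases ?_ (fun j => ?_) i
    · have e := K.appl_comp_curry (K.toOne X) (K.dummies b (K.fst b K.one) k) (q 0)
      refine (congrArg (fun m => K.applPow b k m fun i => q i.succ) e).trans ?_
      rw [applPow_dummies, K.pair_fst]
    · have e := K.appl_comp_curry (K.toOne X) (K.comp (K.snd b K.one) (K.curriedProj b k j)) (q 0)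
      rw [K.pair_snd_assoc] at e
      exact (congrArg (fun m => K.applPow b k m fun i => q i.succ) e).trans (ih j _)

end CartClosed

/-! ### Soundness of the interpretation for structural congruence -/

namespace PCFModel

variable (M : PCFModel.{v, u})

/-- The interpretation of a renaming. -/
def interpRen {Γ : List Ty} : {Δ : List Ty} → Ren Δ Γ → M.Hom (M.ctxObj Γ) (M.ctxObj Δ)
  | [], _ => M.toOne _
  | _ :: _, ρ => M.pair (M.lookup M.nat (ρ _ .zero)) (interpRen (fun T x => ρ T x.succ))

/-- The interpretation of a substitution. -/
def interpSub {Γ : List Ty} : {Δ : List Ty} → Sub Δ Γ → M.Hom (M.ctxObj Γ) (M.ctxObj Δ)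
  | [], _ => M.toOne _
  | _ :: _, σ => M.pair (M.interp (σ _ .zero)) (interpSub (fun T x => σ T x.succ))

theorem ctx_hom_ext {X : M.Obj} {Δ : List Ty} {f g : M.Hom X (M.ctxObj Δ)}
    (h : ∀ T (x : Var Δ T), M.comp f (M.lookup M.nat x) = M.comp g (M.lookup M.nat x)) :
    f = g := by
  induction Δ with
  | nil => exact (M.toOne_unique f).trans (M.toOne_unique g).symm
  | cons S Δ ih =>
    refine M.toCartClosed.hom_ext (h S .zero) (ih fun T x => ?_)
    exact (M.assoc _ _ _).trans ((h T x.succ).trans (M.assoc _ _ _).symm)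

theorem interpRen_lookup {Γ Δ : List Ty} (ρ : Ren Δ Γ) {T : Ty} (x : Var Δ T) :
    M.comp (M.interpRen ρ) (M.lookup M.nat x) = M.lookup M.nat (ρ T x) := by
  induction x with
  | zero => exact M.pair_fst _ _
  | succ x ih => exact (M.pair_snd_assoc _ _ _).trans (ih _)

theorem interpSub_lookup {Γ Δ : List Ty} (σ : Sub Δ Γ) {T : Ty} (x : Var Δ T) :
    M.comp (M.interpSub σ) (M.lookup M.nat x) = M.interp (σ T x) := by
  induction x with
  | zero => exact M.pair_fst _ _
  | succ x ih => exact (M.pair_snd_assoc _ _ _).trans (ih _)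

theorem interp_rename {Γ Δ : List Ty} {T : Ty} (P : Tm Δ T) (ρ : Ren Δ Γ) :
    M.interp (P.rename ρ) = M.comp (M.interpRen ρ) (M.interp P) := by
  induction P generalizing Γ with
  | var x => exact (M.interpRen_lookup ρ x).symm
  | @lam Δ S T P ih =>
    refine (congrArg M.curry (ih (ρ.lift S))).trans ?_
    refine Eq.trans ?_ (M.comp_curry _ _).symm
    congr 2
    refine congrArg (M.pair _) (M.ctx_hom_ext fun T x => ?_)
    refine (M.interpRen_lookup _ x).trans (Eq.trans ?_ (M.assoc _ _ _).symm)
    rw [interpRen_lookup]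
    rfl
  | app P Q ihP ihQ =>
    exact (congrArg₂ M.appl (ihP _) (ihQ _)).trans (M.comp_appl _ _ _).symm
  | fix T => exact (M.comp_toOne_assoc _ _).symm
  | omega => exact (M.comp_toOne_assoc _ _).symm
  | num n => exact (M.comp_toOne_assoc _ _).symm
  | case k =>
    exact (congrArg M.curry (M.pair_fst_assoc _ _ _).symm).trans (M.comp_curry _ _).symm

theorem interp_weaken {Γ : List Ty} {T : Ty} (S : Ty) (P : Tm Γ T) :
    M.interp (P.weaken S) = M.comp (M.snd (M.tyObj S) (M.ctxObj Γ)) (M.interp P) := by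
  rw [Tm.weaken, interp_rename]
  congr 1
  refine M.ctx_hom_ext fun T x => ?_
  rw [interpRen_lookup]
  rfl

theorem interp_subst {Γ Δ : List Ty} {T : Ty} (P : Tm Δ T) (σ : Sub Δ Γ) :
    M.interp (P.subst σ) = M.comp (M.interpSub σ) (M.interp P) := by
  induction P generalizing Γ with
  | var x => exact (M.interpSub_lookup σ x).symm
  | @lam Δ S T P ih =>
    refine (congrArg M.curry (ih (σ.lift S))).trans ?_
    refine Eq.trans ?_ (M.comp_curry _ _).symm
    congr 2
    refine congrArg (M.pair _) (M.ctx_hom_ext fun T x => ?_)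
    refine (M.interpSub_lookup _ x).trans (Eq.trans ?_ (M.assoc _ _ _).symm)
    rw [interpSub_lookup]
    exact M.interp_weaken S _
  | app P Q ihP ihQ =>
    exact (congrArg₂ M.appl (ihP _) (ihQ _)).trans (M.comp_appl _ _ _).symm
  | fix T => exact (M.comp_toOne_assoc _ _).symm
  | omega => exact (M.comp_toOne_assoc _ _).symm
  | num n => exact (M.comp_toOne_assoc _ _).symm
  | case k =>
    exact (congrArg M.curry (M.pair_fst_assoc _ _ _).symm).trans (M.comp_curry _ _).symm

theorem interpSub_single {Γ : List Ty} {S : Ty} (N : Tm Γ S) :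
    M.interpSub (Sub.single N) = M.pair (M.interp N) (M.id _) := by
  refine congrArg (M.pair _) (M.ctx_hom_ext fun T x => ?_)
  rw [interpSub_lookup, M.id_comp]
  rfl

/-- The body of the recursion combinator, `F ⊢ λ f. f (F f)`. -/
def recBody (A : M.Obj) :
    M.Hom (M.exp (M.exp A A) A) (M.exp (M.exp A A) A) :=
  M.curry (M.appl (M.fst (M.exp A A) (M.exp (M.exp A A) A))
    (M.appl (M.snd (M.exp A A) (M.exp (M.exp A A) A))
      (M.fst (M.exp A A) (M.exp (M.exp A A) A))))

theorem appl_comp_recBody {X A : M.Obj} (F : M.Hom X (M.exp (M.exp A A) A))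
    (f : M.Hom X (M.exp A A)) :
    M.appl (M.comp F (M.recBody A)) f = M.appl f (M.appl F f) := by
  rw [recBody, M.appl_comp_curry, M.comp_appl, M.comp_appl, M.pair_fst, M.pair_snd]

theorem appl_recursor {X A : M.Obj} (f : M.Hom X (M.exp A A)) :
    M.appl (M.comp (M.toOne X) (M.recursor A)) f =
      M.appl f (M.appl (M.comp (M.toOne X) (M.recursor A)) f) := by
  rw [← appl_comp_recBody, M.assoc]
  congr 2
  exact (M.fixpt_comp _).symm

theorem interp_cong {Γ : List Ty} {T : Ty} {P Q : Tm Γ T} (h : Cong P Q) :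
    M.interp P = M.interp Q := by
  induction h with
  | refl => rfl
  | symm _ ih => exact ih.symm
  | trans _ _ ih ih' => exact ih.trans ih'
  | lam _ ih => exact congrArg M.curry ih
  | app _ _ ih ih' => exact congrArg₂ M.appl ih ih'
  | beta P N =>
    rw [interp_subst, interpSub_single]
    exact M.appl_curry _ _
  | @eta Γ S T P =>
    refine Eq.trans (congrArg M.curry ?_) (M.curry_appl_fst (M.interp P))
    exact congrArg₂ M.appl (M.interp_weaken S P) rfl
  | unfold P => exact M.appl_recursor _

theorem interp_appPow {Γ : List Ty} (k : ℕ) (P : Tm Γ (natPow k)) (Q : Fin k → Tm Γ Ty.nat) :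
    M.interp (appPow k P Q) = M.applPow M.nat k (M.interp P) (fun i => M.interp (Q i)) := by
  induction k with
  | zero => rfl
  | succ k ih => exact ih _ _

theorem interp_appVars {Γ : List Ty} (Δ : List Ty) {U : Ty} (P : Tm Γ (arrows Δ U))
    (A : ∀ V : Ty, Var Δ V → Tm Γ V) :
    M.interp (Tm.appVars Δ P A) =
      M.applVars M.nat Δ (M.interp P) (fun V y => M.interp (A V y)) := by
  induction Δ generalizing U with
  | nil => rfl
  | cons T Δ ih => exact congrArg₂ M.appl (ih (U := Ty.arr T U) _ _) rfl

theorem interp_closure (Γ : List Ty) {U : Ty} (P : Tm Γ U) :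
    M.interp (Tm.closure Γ P) = M.close M.nat Γ (M.interp P) := by
  induction Γ generalizing U with
  | nil => rfl
  | cons T Γ ih => exact ih _

/-- Abstraction followed by application to the variables of the context is the identity. -/
theorem applVars_close (Γ : List Ty) {U : Ty} (f : M.Hom (M.ctxObj Γ) (M.tyObj U)) {X : M.Obj}
    (γ : M.Hom X (M.ctxObj Γ)) :
    M.applVars M.nat Γ (M.comp (M.toOne X) (M.close M.nat Γ f))
      (fun _ y => M.comp γ (M.lookup M.nat y)) = M.comp γ f := by
  induction Γ generalizing U with
  | nil =>
    refine congrArg (fun k => M.comp k f) (M.toOne_unique γ).symm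
  | cons T Γ ih =>
    have e := ih (U := Ty.arr T U) (M.curry f) (M.comp γ (M.snd _ _))
    have e' : (fun V (y : Var Γ V) => M.comp (M.comp γ (M.snd _ _)) (M.lookup M.nat y)) =
        fun V y => M.comp γ (M.lookup M.nat (Var.succ (S := T) y)) := by
      funext V y
      exact M.assoc _ _ _
    rw [e'] at e
    refine (congrArg₂ M.appl e rfl).trans ?_
    refine (M.appl_comp_curry _ _ _).trans ?_
    exact congrArg (fun k => M.comp k f) (M.pair_eta γ)

/-! ### Computational adequacy -/

/-- The base type is interpreted by a flat domain whose points are `⊥` and the numerals, on which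
`case` computes, and `⊥` is a function with constant value `⊥`. -/
structure FlatBase : Prop where
  num_case : ∀ (k : ℕ) (i : Fin k), M.comp (M.num i) (M.case k) = M.curriedProj M.nat k i
  num_case_of_le : ∀ (k n : ℕ), k ≤ n → M.comp (M.num n) (M.case k) = M.bot _
  bot_case : ∀ k : ℕ, M.comp (M.bot M.nat) (M.case k) = M.bot _
  appl_bot : ∀ {A B : M.Obj} (a : M.Hom M.one A), M.appl (M.bot (M.exp A B)) a = M.bot B
  eq_bot_or_num : ∀ f : M.Hom M.one M.nat, f = M.bot M.nat ∨ ∃ n, f = M.num n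
  num_ne_bot : ∀ n : ℕ, M.num n ≠ M.bot M.nat
  num_injective : Function.Injective M.num

/-- Plotkin's logical relation between points of the model and closed terms: at base type, a
numeral is related only to the programs that evaluate to it. -/
def Rel : (T : Ty) → M.Hom M.one (M.tyObj T) → Tm [] T → Prop
  | .nat, d, P => ∀ n : ℕ, d = M.num n → Eval P n
  | .arr S T, d, P => ∀ (e : M.Hom M.one (M.tyObj S)) (N : Tm [] S), Rel S e N →
      Rel T (M.appl d e) (.app P N)

variable {M}

theorem Rel.conv {T : Ty} {d : M.Hom M.one (M.tyObj T)} {P P' : Tm [] T} (hc : Cong P P')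
    (h : M.Rel T d P') : M.Rel T d P := by
  induction T with
  | nat => exact fun n e => .conv hc (h n e)
  | arr S T _ ih => exact fun e N hN => ih (.app hc (.refl N)) (h e N hN)

/-- The logical relation is admissible: since the tests are applications to related arguments, it
is enough that fixpoints are observed through their approximations. -/
theorem Rel.fixpt (hM : M.Observable) {T : Ty} {A : M.Obj} (f : M.Hom A A)
    (g : M.Hom A (M.tyObj T)) {P : Tm [] T} (h : ∀ k, M.Rel T (M.comp (M.iter f k) g) P) :
    M.Rel T (M.comp (M.fixpt f) g) P := by
  induction T with
  | nat =>
    intro n e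
    obtain ⟨k, hk⟩ := (hM.fixpt_obs f g n).1 e
    exact h k n hk
  | arr S T _ ih =>
    intro e N hN
    have key : ∀ x : M.Hom M.one A, M.appl (M.comp x g) e =
        M.comp x (M.appl g (M.comp (M.toOne A) e)) := by
      intro x
      refine Eq.trans ?_ (M.comp_appl x g _).symm
      rw [M.comp_toOne_assoc, M.toOne_one_comp]
    refine Eq.mpr (congrArg (fun d => M.Rel T d (.app P N)) (key _)) (ih _ fun k => ?_)
    exact Eq.mp (congrArg (fun d => M.Rel T d (.app P N)) (key _)) (h k e N hN)

theorem FlatBase.rel_bot (hB : M.FlatBase) (T : Ty) (P : Tm [] T) :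
    M.Rel T (M.bot (M.tyObj T)) P := by
  induction T with
  | nat => exact fun n e => absurd e.symm (hB.num_ne_bot n)
  | arr S T _ ih =>
    intro e N _
    exact Eq.mpr (congrArg (fun d => M.Rel T d (.app P N)) (hB.appl_bot e)) (ih _)

theorem FlatBase.rel_fix (hB : M.FlatBase) (hM : M.Observable) (T : Ty) :
    M.Rel (.arr (.arr T T) T) (M.recursor (M.tyObj T)) (.fix T) := by
  have h : ∀ k, M.Rel (.arr (.arr T T) T)
      (M.comp (M.iter (M.recBody (M.tyObj T)) k) (M.id _)) (.fix T) := by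
    intro k
    refine Eq.mpr (congrArg (fun d => M.Rel (.arr (.arr T T) T) d (.fix T)) (M.comp_id _)) ?_
    induction k with
    | zero => exact hB.rel_bot _ _
    | succ k ih =>
      intro f N hN
      refine Eq.mpr (congrArg (fun d => M.Rel T d (.app (.fix T) N))
        (M.appl_comp_recBody _ _)) ?_
      exact Rel.conv (.unfold N) (hN _ _ (ih f N hN))
  have := Rel.fixpt hM _ _ h
  exact Eq.mp (congrArg (fun d => M.Rel (.arr (.arr T T) T) d (.fix T)) (M.comp_id _)) this

theorem rel_natPow (k : ℕ) (m : M.Hom M.one (M.tyObj (natPow k))) (P : Tm [] (natPow k))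
    (h : ∀ (q : Fin k → M.Hom M.one M.nat) (Q : Fin k → Tm [] Ty.nat),
      (∀ i, M.Rel Ty.nat (q i) (Q i)) → M.Rel Ty.nat (M.applPow M.nat k m q) (appPow k P Q)) :
    M.Rel (natPow k) m P := by
  induction k with
  | zero => exact h Fin.elim0 Fin.elim0 fun i => i.elim0
  | succ k ih =>
    intro e N hN
    refine ih _ _ fun q Q hQ => ?_
    exact h (Fin.cons e q) (Fin.cons N Q) (Fin.cases hN hQ)

theorem FlatBase.applPow_bot (hB : M.FlatBase) (k : ℕ) (q : Fin k → M.Hom M.one M.nat) :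
    M.applPow M.nat k (M.bot (M.tyObj (natPow k))) q = M.bot M.nat := by
  induction k with
  | zero => rfl
  | succ k ih =>
    exact (congrArg (fun m => M.applPow M.nat k m fun i => q i.succ) (hB.appl_bot _)).trans (ih _)

theorem FlatBase.applPow_num_case (hB : M.FlatBase) {k : ℕ} (i : Fin k)
    (q : Fin k → M.Hom M.one M.nat) :
    M.applPow M.nat k (M.comp (M.num i) (M.case k)) q = q i := by
  rw [hB.num_case, ← M.toOne_one_comp (M.curriedProj M.nat k i)]
  exact M.applPow_curriedProj M.nat k i q

theorem FlatBase.applPow_bot_case (hB : M.FlatBase) (k : ℕ) (q : Fin k → M.Hom M.one M.nat) :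
    M.applPow M.nat k (M.comp (M.bot M.nat) (M.case k)) q = M.bot M.nat := by
  rw [hB.bot_case, hB.applPow_bot]

theorem FlatBase.applPow_num_case_of_le (hB : M.FlatBase) {k n : ℕ} (h : k ≤ n)
    (q : Fin k → M.Hom M.one M.nat) :
    M.applPow M.nat k (M.comp (M.num n) (M.case k)) q = M.bot M.nat := by
  rw [hB.num_case_of_le k n h, hB.applPow_bot]

theorem FlatBase.rel_case (hB : M.FlatBase) (k : ℕ) :
    M.Rel (.arr .nat (natPow k)) (M.interp (.case k : Tm [] _)) (.case k) := by
  intro d P hP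
  refine rel_natPow k _ _ fun q Q hQ n hn => ?_
  have e : M.appl (M.interp (.case k : Tm [] _)) d = M.comp d (M.case k) := by
    refine (M.appl_curry _ _).trans ?_
    exact M.pair_fst_assoc _ _ _
  replace hn : M.applPow M.nat k (M.comp d (M.case k)) q = M.num n :=
    (congrArg (fun m => M.applPow M.nat k m q) e).symm.trans hn
  rcases hB.eq_bot_or_num d with rfl | ⟨i, rfl⟩
  · exact absurd (hn.symm.trans (hB.applPow_bot_case k q)) (hB.num_ne_bot n)
  · rcases lt_or_ge i k with h | h
    · have h1 := hB.applPow_num_case ⟨i, h⟩ q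
      exact .case ⟨i, h⟩ (hP i rfl) (hQ ⟨i, h⟩ n (h1.symm.trans hn))
    · exact absurd (hn.symm.trans (hB.applPow_num_case_of_le h q)) (hB.num_ne_bot n)

/-- The fundamental lemma of the logical relation. -/
theorem FlatBase.rel_subst (hB : M.FlatBase) (hM : M.Observable) {Γ : List Ty} {T : Ty}
    (P : Tm Γ T) (γ : M.Hom M.one (M.ctxObj Γ)) (σ : Sub Γ [])
    (h : ∀ (S : Ty) (x : Var Γ S), M.Rel S (M.comp γ (M.lookup M.nat x)) (σ S x)) :
    M.Rel T (M.comp γ (M.interp P)) (P.subst σ) := by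
  have closed : ∀ {U : Ty} (d : M.Hom M.one (M.tyObj U)) (N : Tm [] U), M.Rel U d N →
      ∀ {Δ : List Ty} (δ : M.Hom M.one (M.ctxObj Δ)),
        M.Rel U (M.comp δ (M.comp (M.toOne _) d)) N := by
    intro U d N hd Δ δ
    rw [M.comp_toOne_assoc, M.toOne_one_comp]
    exact hd
  induction P with
  | var x => exact h _ x
  | @lam Γ S T P ih =>
    intro e N hN
    refine Eq.mpr (congrArg (fun d => M.Rel T d _) (M.appl_comp_curry _ _ _)) ?_
    refine Rel.conv (.beta _ _) ?_
    rw [Tm.subst_lift_single]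
    refine ih _ _ fun U x => ?_
    cases x with
    | zero => exact Eq.mpr (congrArg (fun d => M.Rel S d N) (M.pair_fst _ _)) hN
    | succ x => exact Eq.mpr (congrArg (fun d => M.Rel U d _) (M.pair_snd_assoc _ _ _)) (h U x)
  | @app Γ S T P Q ihP ihQ =>
    refine Eq.mpr (congrArg (fun d => M.Rel T d _) (M.comp_appl _ _ _)) ?_
    exact ihP γ σ h _ _ (ihQ γ σ h)
  | fix T => exact closed (U := .arr (.arr T T) T) _ _ (hB.rel_fix hM T) γ
  | omega => exact closed (U := .nat) _ _ (hB.rel_bot .nat _) γ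
  | num n =>
    refine closed (U := .nat) _ _ (fun m e => ?_) γ
    rw [hB.num_injective e]
    exact .num m
  | @case Γ k =>
    have e : M.comp γ (M.interp (.case k : Tm Γ _)) = M.interp (.case k : Tm [] _) := by
      refine (M.comp_curry _ _).trans (congrArg M.curry ?_)
      exact M.pair_fst_assoc _ _ _
    exact Eq.mpr (congrArg (fun d => M.Rel (.arr .nat (natPow k)) d _) e) (hB.rel_case k)

/-- Computational adequacy. -/
theorem FlatBase.eval_iff (hB : M.FlatBase) (hM : M.Observable) (P : Tm [] Ty.nat) (n : ℕ) :
    Eval P n ↔ M.interp P = M.num n := by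
  constructor
  · intro h
    induction h with
    | conv hc _ ih => exact (M.interp_cong hc).trans ih
    | num n => exact M.toOne_one_comp _
    | @case k P Q n i _ _ ihP ihQ =>
      rw [interp_appPow]
      have e : M.interp (.app (.case k) P) = M.comp (M.num i) (M.case k) := by
        refine (M.appl_curry _ _).trans ?_
        exact (M.pair_fst_assoc _ _ _).trans (congrArg (fun d => M.comp d (M.case k)) ihP)
      rw [e]
      exact (hB.applPow_num_case i fun i => M.interp (Q i)).trans ihQ
  · intro e
    have h := hB.rel_subst hM P (M.toOne _) (fun _ => Tm.var) (fun S x => nomatch x)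
    rw [Tm.subst_var] at h
    exact h n ((M.toOne_one_comp _).trans e)

/-! ### Soundness of the quotient -/

theorem quotient_lookup {Γ : List Ty} {T : Ty} (x : Var Γ T) :
    M.quotientCartClosed.lookup M.nat x = M.toQ (M.lookup M.nat x) := by
  induction x with
  | zero => rfl
  | @succ Γ S T x ih =>
    exact congrArg (M.quotientCartClosed.comp (M.toQ (M.snd (M.tyObj S) (M.ctxObj Γ)))) ih

theorem quotient_interp (hM : M.Observable) {Γ : List Ty} {T : Ty} (P : Tm Γ T) :
    (M.quotientModel hM).interp P = M.toQ (M.interp P) := by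
  induction P with
  | var x => exact quotient_lookup x
  | lam P ih => exact congrArg M.quotientCartClosed.curry ih
  | app P Q ihP ihQ => exact congrArg₂ M.quotientCartClosed.appl ihP ihQ
  | _ => rfl

theorem IntrinsicLE.appl {X A B : M.Obj} {f f' : M.Hom X (M.exp A B)} {a a' : M.Hom X A}
    (h : M.IntrinsicLE f f') (h' : M.IntrinsicLE a a') :
    M.IntrinsicLE (M.appl f a) (M.appl f' a') :=
  (h'.pair h).comp_right _

theorem intrinsicLE_plug {Γ : List Ty} {T : Ty} {P Q : Tm Γ T}
    (h : M.IntrinsicLE (M.interp P) (M.interp Q)) {Δ : List Ty} {U : Ty} (K : Ctxt Γ T Δ U) :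
    M.IntrinsicLE (M.interp (K.plug P)) (M.interp (K.plug Q)) := by
  induction K with
  | hole ρ hρ =>
    simp only [Ctxt.plug, interp_rename]
    exact h.comp_left _
  | term N => exact .refl M _
  | lam K ih => exact ih.curry
  | app K L ihK ihL => exact ihK.appl ihL

theorem FlatBase.sound (hB : M.FlatBase) (hM : M.Observable) : (M.quotientModel hM).Sound := by
  intro Γ T P Q h K n e
  rw [quotient_interp, quotient_interp] at h
  have h1 := intrinsicLE_iff_pointLE.1 (intrinsicLE_plug (toQ_le.1 h) K) (M.id _) n
  exact (hB.eval_iff hM _ n).2 ((M.comp_id _).symm.trans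
    (h1 ((M.comp_id _).trans ((hB.eval_iff hM _ n).1 e))))

end PCFModel

open AffineCategory StandardDatatypes

section Contraction

variable {C : Type u} [Category.{v} C] [SemiCartesianMonoidalCategory C]
    [SymmetricCategory C] [MonoidalClosed C] [HasFiniteProducts C] [AffineCategory C]

/-! ### Contraction is a coassociative counital comultiplication -/

theorem lift_seely {X A B : C} (f : bang X ⟶ A) (g : bang X ⟶ B) :
    prom (prod.lift f g) ≫ (seely A B).hom = con X ≫ (prom f ⊗ₘ prom g) := by
  rw [con, Category.assoc, ← seely_prom, bangMap, ← Category.assoc, prom_prom, ← bangMap]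
  congr 2
  have h : ∀ k : X ⨯ X ⟶ X, prod.lift (𝟙 X) (𝟙 X) ≫ k = 𝟙 X →
      bangMap (prod.lift (𝟙 X) (𝟙 X)) ≫ bangMap k = 𝟙 _ := by
    intro k hk
    rw [bangMap, prom_bangMap, Category.assoc, hk, Category.comp_id, prom_der_self]
  rw [prod.comp_lift, ← Category.assoc, ← Category.assoc, h _ (prod.lift_fst _ _),
    h _ (prod.lift_snd _ _), Category.id_comp, Category.id_comp]

theorem con_eq (A : C) : con A = prom (prod.lift (der A) (der A)) ≫ (seely A A).hom := by
  rw [lift_seely, prom_der_self, id_tensorHom_id, Category.comp_id]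

theorem lift_der_seely {X A : C} (f : bang X ⟶ A) :
    prom (prod.lift f (der X)) ≫ (seely A X).hom = con X ≫ (prom f ▷ bang X) := by
  rw [lift_seely, prom_der_self, tensorHom_id]

theorem lift_der_seely' {X A : C} (f : bang X ⟶ A) :
    prom (prod.lift (der X) f) ≫ (seely X A).hom = con X ≫ (bang X ◁ prom f) := by
  rw [lift_seely, prom_der_self, id_tensorHom]

theorem con_assoc (A : C) :
    con A ≫ (con A ▷ bang A) ≫ (α_ (bang A) (bang A) (bang A)).hom = con A ≫ (bang A ◁ con A) := by
  conv_lhs => rw [con_eq A, comp_whiskerRight, ← con_eq A]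
  conv_rhs => rw [con_eq A, MonoidalCategory.whiskerLeft_comp, ← con_eq A]
  rw [Category.assoc, ← Category.assoc (con A), ← lift_der_seely, Category.assoc,
    ← seely_assoc, ← Category.assoc (prom _) (prom _), ← Category.assoc (con A),
    ← lift_der_seely', prom_prom, ← Category.assoc (prom _) (der _), prom_der, Category.assoc]
  congr 2
  refine (prod.comp_lift _ _ _).trans (congrArg₂ prod.lift ?_ ?_)
  · exact (prod.lift_fst_assoc _ _ _).trans (prod.lift_fst _ _)
  · refine (prod.comp_lift _ _ _).trans (congrArg₂ prod.lift ?_ (prod.lift_snd _ _))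
    exact (prod.lift_fst_assoc _ _ _).trans (prod.lift_snd _ _)

theorem con_assoc_assoc {A Z : C} (h : bang A ⊗ bang A ⊗ bang A ⟶ Z) :
    con A ≫ (con A ▷ bang A) ≫ (α_ (bang A) (bang A) (bang A)).hom ≫ h =
      con A ≫ (bang A ◁ con A) ≫ h := by
  simpa only [Category.assoc] using congrArg (· ≫ h) (con_assoc A)

theorem toUnit_eq_prom (X : C) :
    toUnit (bang X) = prom (toUnit (bang X)) ≫ (seelyUnit (C := C)).hom :=
  toUnit_unique _ _

theorem con_toUnit_left (A : C) :
    con A ≫ (toUnit (bang A) ▷ bang A) ≫ (λ_ (bang A)).hom = 𝟙 _ := by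
  rw [toUnit_eq_prom, comp_whiskerRight, Category.assoc, ← Category.assoc (con A),
    ← lift_der_seely, Category.assoc, seely_left_unit, prom_prom, ← Category.assoc, prom_der,
    prod.lift_snd, prom_der_self]

theorem con_toUnit_left_assoc {A Z : C} (h : bang A ⟶ Z) :
    con A ≫ (toUnit (bang A) ▷ bang A) ≫ (λ_ (bang A)).hom ≫ h = h := by
  simpa only [Category.assoc, Category.id_comp] using congrArg (· ≫ h) (con_toUnit_left A)

theorem con_toUnit_right (A : C) :
    con A ≫ (bang A ◁ toUnit (bang A)) ≫ (ρ_ (bang A)).hom = 𝟙 _ := by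
  rw [toUnit_eq_prom, MonoidalCategory.whiskerLeft_comp, Category.assoc, ← Category.assoc (con A),
    ← lift_der_seely', Category.assoc, seely_right_unit, prom_prom, ← Category.assoc, prom_der,
    prod.lift_fst, prom_der_self]

/-! ### Application with a shared resource -/

/-- The morphism `m : !X ⟶ A ⊸ B` applied to `g : !X ⟶ A`, the two sharing their argument. -/
noncomputable def linAppl {X A B : C} (g : bang X ⟶ A) (m : bang X ⟶ lolli A B) : bang X ⟶ B :=
  con X ≫ (bang X ◁ m) ≫ (g ▷ lolli A B) ≫ (ihom.ev A).app B

/-- The head variable `m` is passed to the linear map `k`, whose result shares the argument. -/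
noncomputable def headAppl {X L D : C} (m : bang X ⟶ L) (k : L ⟶ lolli (bang X) D) : bang X ⟶ D :=
  con X ≫ (bang X ◁ m) ≫ MonoidalClosed.uncurry k

theorem headOccurrence_eq {A B : C} (f : A ⟶ lolli (bang A) B) :
    headOccurrence f = headAppl (der A) f := rfl

theorem headAppl_comp {X L L' D : C} (m : bang X ⟶ L) (p : L ⟶ L')
    (k : L' ⟶ lolli (bang X) D) : headAppl (m ≫ p) k = headAppl m (p ≫ k) := by
  rw [headAppl, headAppl, MonoidalClosed.uncurry_natural_left]
  simp only [MonoidalCategory.whiskerLeft_comp, Category.assoc]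

theorem headAppl_toUnit {X L D : C} (p : 𝟙_ C ⟶ L) (k : L ⟶ lolli (bang X) D) :
    headAppl (toUnit (bang X) ≫ p) k = (ρ_ _).inv ≫ MonoidalClosed.uncurry (p ≫ k) := by
  rw [headAppl_comp, headAppl]
  have h := con_toUnit_right X
  rw [← Category.assoc, ← cancel_mono (ρ_ (bang X)).inv, Category.assoc, Iso.hom_inv_id,
    Category.comp_id, Category.id_comp] at h
  rw [← Category.assoc, h]

/-- The extension of `(g, h)` applies its function to `g` and passes the result to `h`; the two uses
of the shared resource are merged by coassociativity of contraction. -/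
theorem headAppl_linearExt {X A B D : C} (m : bang X ⟶ lolli A B) (g : bang X ⟶ A)
    (h : B ⟶ lolli (bang X) D) :
    headAppl m (linearExt g h) = headAppl (linAppl g m) h := by
  rw [headAppl, linearExt, MonoidalClosed.uncurry_curry, headAppl, linAppl]
  rw [whisker_exchange_assoc, associator_naturality_right_assoc, con_assoc_assoc]
  simp only [MonoidalCategory.whiskerLeft_comp, Category.assoc]

/-- Application in `K_!(C)` is linear application to a promoted argument. -/
theorem appl_eq_linAppl {X A B : C} (m : bang X ⟶ lolli (bang A) B) (a : bang X ⟶ A) :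
    (coKleisli C).appl m a = linAppl (prom a) m := by
  have h := lift_seely a m
  change prom (prod.lift a m) ≫ (seely A (lolli (bang A) B)).hom ≫
    (bang A ◁ der (lolli (bang A) B)) ≫ (ihom.ev (bang A)).app B = _
  rw [← Category.assoc, h, linAppl, Category.assoc, whisker_exchange_assoc,
    MonoidalCategory.tensorHom_def, Category.assoc,
    ← MonoidalCategory.whiskerLeft_comp_assoc, prom_der]

end Contraction

section Uncurrying

variable {C : Type u} [Category.{v} C] [SemiCartesianMonoidalCategory C]
    [SymmetricCategory C] [MonoidalClosed C] [HasFiniteProducts C] [AffineCategory C]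

/-! ### Uncurrying iterated function spaces -/

/-- The canonical morphism `B ⊸ (A ⊸ U) ⟶ (A ⊗ B) ⊸ U`. -/
def lolliUncurry (A B U : C) : lolli B (lolli A U) ⟶ lolli (A ⊗ B) U :=
  MonoidalClosed.curry ((α_ A B _).hom ≫ (A ◁ (ihom.ev B).app (lolli A U)) ≫ (ihom.ev A).app U)

instance isIso_lolliUncurry (A B U : C) : IsIso (lolliUncurry A B U) := by
  refine isIso_of_yoneda_map_bijective _ fun Y => ?_
  have h : ∀ k : Y ⟶ lolli B (lolli A U), k ≫ lolliUncurry A B U = MonoidalClosed.curry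
      ((α_ A B Y).hom ≫ MonoidalClosed.uncurry (MonoidalClosed.uncurry k)) := by
    intro k
    rw [lolliUncurry, ← MonoidalClosed.curry_natural_left, associator_naturality_right_assoc,
      MonoidalClosed.uncurry_eq (MonoidalClosed.uncurry k), MonoidalClosed.uncurry_eq k]
    simp only [MonoidalCategory.whiskerLeft_comp, Category.assoc]
  constructor
  · intro k k' e
    replace e := (h k).symm.trans (e.trans (h k'))
    have e' := MonoidalClosed.curry_injective e
    rw [cancel_epi] at e'
    exact MonoidalClosed.uncurry_injective (MonoidalClosed.uncurry_injective e')
  · intro k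
    refine ⟨MonoidalClosed.curry (MonoidalClosed.curry
      ((α_ A B Y).inv ≫ MonoidalClosed.uncurry k)), ?_⟩
    refine (h _).trans ?_
    rw [MonoidalClosed.uncurry_curry, MonoidalClosed.uncurry_curry, Iso.hom_inv_id_assoc,
      MonoidalClosed.curry_uncurry]

/-- Two successive applications to arguments that share the resource `!X` are one application to
their tensor product. -/
theorem linAppl_linAppl {X A B U : C} (g₁ : bang X ⟶ A) (g₂ : bang X ⟶ B)
    (m : bang X ⟶ lolli B (lolli A U)) :
    linAppl g₁ (linAppl g₂ m) = linAppl (con X ≫ (g₁ ⊗ₘ g₂)) (m ≫ lolliUncurry A B U) := by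
  have h : ((A ⊗ B) ◁ lolliUncurry A B U) ≫ (ihom.ev (A ⊗ B)).app U =
      (α_ A B _).hom ≫ (A ◁ (ihom.ev B).app (lolli A U)) ≫ (ihom.ev A).app U := by
    rw [← MonoidalClosed.uncurry_eq, lolliUncurry, MonoidalClosed.uncurry_curry]
  symm
  rw [linAppl, MonoidalCategory.whiskerLeft_comp, Category.assoc, whisker_exchange_assoc, h,
    comp_whiskerRight, Category.assoc, whisker_exchange_assoc, MonoidalCategory.tensorHom_def,
    comp_whiskerRight, Category.assoc, associator_naturality_middle_assoc,
    associator_naturality_left_assoc, associator_naturality_right_assoc, con_assoc_assoc]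
  simp only [linAppl, MonoidalCategory.whiskerLeft_comp, Category.assoc]
  rw [← whisker_exchange_assoc, ← whisker_exchange_assoc]
  simp only [whisker_exchange_assoc]

theorem linAppl_comp {X A A' U : C} (g : bang X ⟶ A) (s : A ⟶ A') (m : bang X ⟶ lolli A' U) :
    linAppl (g ≫ s) m = linAppl g (m ≫ (MonoidalClosed.pre s).app U) := by
  symm
  rw [linAppl, MonoidalCategory.whiskerLeft_comp, Category.assoc, whisker_exchange_assoc,
    MonoidalClosed.id_tensor_pre_app_comp_ev, linAppl, comp_whiskerRight, Category.assoc]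

instance isIso_pre_app {A A' U : C} (s : A ⟶ A') [IsIso s] :
    IsIso ((MonoidalClosed.pre s).app U) := by
  refine ⟨(MonoidalClosed.pre (inv s)).app U, ?_, ?_⟩
  · rw [← NatTrans.comp_app, ← MonoidalClosed.pre_map, IsIso.inv_hom_id, MonoidalClosed.pre_id]
    rfl
  · rw [← NatTrans.comp_app, ← MonoidalClosed.pre_map, IsIso.hom_inv_id, MonoidalClosed.pre_id]
    rfl

/-- The canonical isomorphism `U ⟶ !1 ⊸ U`. -/
def lolliUnit (U : C) : U ⟶ lolli (bang (𝟙_ C)) U :=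
  MonoidalClosed.curry ((seelyUnit.hom ▷ U) ≫ (λ_ U).hom)

instance isIso_lolliUnit (U : C) : IsIso (lolliUnit U) := by
  refine isIso_of_yoneda_map_bijective _ fun Y => ?_
  have h : ∀ k : Y ⟶ U, k ≫ lolliUnit U =
      MonoidalClosed.curry ((seelyUnit.hom ▷ Y) ≫ (λ_ Y).hom ≫ k) := by
    intro k
    rw [lolliUnit, ← MonoidalClosed.curry_natural_left, whisker_exchange_assoc,
      leftUnitor_naturality]
  constructor
  · intro k k' e
    replace e := (h k).symm.trans (e.trans (h k'))
    have e' := MonoidalClosed.curry_injective e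
    rwa [cancel_epi, cancel_epi] at e'
  · intro k
    refine ⟨(λ_ Y).inv ≫ (seelyUnit.inv ▷ Y) ≫ MonoidalClosed.uncurry k, ?_⟩
    refine (h _).trans ?_
    rw [Iso.hom_inv_id_assoc, hom_inv_whiskerRight_assoc, MonoidalClosed.curry_uncurry]

theorem linAppl_lolliUnit {X U : C} (g : bang X ⟶ bang (𝟙_ C)) (m : bang X ⟶ U) :
    linAppl g (m ≫ lolliUnit U) = m := by
  have h : ((bang (𝟙_ C)) ◁ lolliUnit U) ≫ (ihom.ev (bang (𝟙_ C))).app U =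
      (seelyUnit.hom ▷ U) ≫ (λ_ U).hom := by
    rw [← MonoidalClosed.uncurry_eq, lolliUnit, MonoidalClosed.uncurry_curry]
  rw [linAppl, MonoidalCategory.whiskerLeft_comp, Category.assoc, whisker_exchange_assoc, h,
    whisker_exchange_assoc, whisker_exchange_assoc, leftUnitor_naturality,
    ← comp_whiskerRight_assoc, toUnit_unique (g ≫ seelyUnit.hom) (toUnit _),
    con_toUnit_left_assoc]

theorem prom_seely {X A B : C} (γ : bang X ⟶ A ⨯ B) :
    prom γ ≫ (seely A B).hom = con X ≫ (prom ((coKleisli C).comp γ ((coKleisli C).fst A B)) ⊗ₘ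
      prom ((coKleisli C).comp γ ((coKleisli C).snd A B))) := by
  rw [← lift_seely]
  exact congrArg (fun k => prom k ≫ (seely A B).hom) ((coKleisli C).pair_eta γ).symm

variable (b : C)

/-- The isomorphism `⟦Δ ⇒ U⟧ ⟶ !⟦Δ⟧ ⊸ ⟦U⟧`. -/
noncomputable def uncurryVars : (Δ : List Ty) → (U : Ty) →
    ((coKleisli C).ty b (arrows Δ U) ⟶ lolli (bang ((coKleisli C).ctx b Δ)) ((coKleisli C).ty b U))
  | [], U => lolliUnit ((coKleisli C).ty b U)
  | T :: Δ, U => uncurryVars Δ (Ty.arr T U) ≫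
      lolliUncurry (bang ((coKleisli C).ty b T)) (bang ((coKleisli C).ctx b Δ))
        ((coKleisli C).ty b U) ≫
      (MonoidalClosed.pre (seely ((coKleisli C).ty b T) ((coKleisli C).ctx b Δ)).hom).app
        ((coKleisli C).ty b U)

instance isIso_uncurryVars (Δ : List Ty) (U : Ty) : IsIso (uncurryVars b Δ U) := by
  induction Δ generalizing U with
  | nil => exact inferInstanceAs (IsIso (lolliUnit _))
  | cons T Δ ih =>
    have := ih (Ty.arr T U)
    exact IsIso.comp_isIso' this (IsIso.comp_isIso' (isIso_lolliUncurry _ _ _) (isIso_pre_app _))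

/-- Application to a tuple of arguments is linear application to its promotion. -/
theorem applVars_eq_linAppl {X : C} (Δ : List Ty) {U : Ty}
    (m : bang X ⟶ (coKleisli C).ty b (arrows Δ U)) (γ : bang X ⟶ (coKleisli C).ctx b Δ) :
    (coKleisli C).applVars b (X := X) Δ (U := U) m
      (fun _ y => (coKleisli C).comp γ ((coKleisli C).lookup b y)) =
      linAppl (prom γ) (m ≫ uncurryVars b Δ U) := by
  induction Δ generalizing U with
  | nil => exact (linAppl_lolliUnit _ _).symm
  | cons T Δ ih =>
    have e := ih (U := Ty.arr T U) m ((coKleisli C).comp γ ((coKleisli C).snd _ _))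
    have e' : (fun V (y : Var Δ V) => (coKleisli C).comp ((coKleisli C).comp γ
        ((coKleisli C).snd _ _)) ((coKleisli C).lookup b y)) =
        fun V y => (coKleisli C).comp γ ((coKleisli C).lookup b (Var.succ (S := T) y)) := by
      funext V y
      exact (coKleisli C).assoc _ _ _
    rw [e'] at e
    refine (congrArg₂ (coKleisli C).appl e rfl).trans ?_
    refine (appl_eq_linAppl _ _).trans ?_
    refine (linAppl_linAppl _ _ _).trans ?_
    have h := prom_seely (A := (coKleisli C).ty b T) (B := (coKleisli C).ctx b Δ) γ
    refine (congrArg (fun g => linAppl g _) h.symm).trans ((linAppl_comp _ _ _).trans ?_)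
    exact congrArg (linAppl _) ((Category.assoc _ _ _).trans (Category.assoc _ _ _))

end Uncurrying

section Decomposition

set_option linter.unusedSectionVars false

variable {C : Type u} [Category.{v} C] [SemiCartesianMonoidalCategory C]
    [SymmetricCategory C] [MonoidalClosed C] [HasFiniteProducts C] [AffineCategory C]
    [BottomMaps C] [StandardDatatypes C] [CpoEnriched C]

/-! ### Least elements -/

@[simp]
theorem comp_botHom {A B D : C} (f : A ⟶ B) : f ≫ botHom B D = botHom A D := by
  simp [botHom]

theorem botHom_unit (A : C) : botHom (𝟙_ C) A = BottomMaps.bot A := by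
  simp [botHom]

theorem uncurry_botHom (A B D : C) :
    MonoidalClosed.uncurry (botHom B (lolli A D)) = botHom (A ⊗ B) D := by
  refine le_antisymm ?_ (CpoEnriched.bot_le _)
  rw [← MonoidalClosed.uncurry_curry (botHom (A ⊗ B) D), MonoidalClosed.uncurry_eq,
    MonoidalClosed.uncurry_eq]
  exact (CpoEnriched.comp_right _).monotone
    ((CpoEnriched.whiskerLeft A).monotone (CpoEnriched.bot_le _))

theorem curry_botHom (A B D : C) :
    MonoidalClosed.curry (botHom (A ⊗ B) D) = botHom B (lolli A D) := by
  rw [← uncurry_botHom, MonoidalClosed.curry_uncurry]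

/-- In an enriched category, split epimorphisms are strict. -/
theorem strict_of_section {A B : C} (f : A ⟶ B) (s : B ⟶ A) (h : s ≫ f = 𝟙 B) : Strict f := by
  have h1 : BottomMaps.bot A ≤ BottomMaps.bot B ≫ s := by
    rw [← botHom_unit A]
    exact CpoEnriched.bot_le _
  have h2 := (CpoEnriched.comp_right f).monotone h1
  refine le_antisymm ?_ ?_
  · simpa [h] using h2
  · rw [← botHom_unit B]
    exact CpoEnriched.bot_le _

theorem Strict.comp {A B D : C} {f : A ⟶ B} {g : B ⟶ D} (hf : Strict f) (hg : Strict g) :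
    Strict (f ≫ g) := by
  rw [Strict, ← Category.assoc, hf, hg]

theorem Total.iso_comp {A B D : C} (f : A ⟶ B) [IsIso f] {g : B ⟶ D} (hg : Total g) :
    Total (f ≫ g) := by
  refine ⟨(strict_of_section f (inv f) (IsIso.inv_hom_id f)).comp hg.1, fun e => hg.2 ?_⟩
  rw [← IsIso.inv_hom_id_assoc f g, e, comp_botHom]

theorem headAppl_botHom {X L D : C} (m : bang X ⟶ L) :
    headAppl m (botHom L (lolli (bang X) D)) = botHom (bang X) D := by
  rw [headAppl, uncurry_botHom, comp_botHom, comp_botHom]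

theorem linAppl_botHom {X A B : C} (g : bang X ⟶ A) :
    linAppl g (botHom (bang X) (lolli A B)) = botHom (bang X) B := by
  rw [linAppl, whisker_exchange_assoc, ← MonoidalClosed.uncurry_eq, uncurry_botHom, comp_botHom,
    comp_botHom]

/-! ### Strict maps out of contexts -/

/-- A strict map from a binary product to a `π`-atomic object is `⊥` or factors, through a total
map, over one of the projections. -/
theorem PiAtomic.prod_cases {A B D : C} (hD : PiAtomic D) (f : A ⨯ B ⟶ D) (hf : Strict f) :
    f = botHom _ _ ∨ (∃ h : A ⟶ D, Total h ∧ f = prod.fst ≫ h) ∨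
      ∃ h : B ⟶ D, Total h ∧ f = prod.snd ≫ h := by
  let F : Fin 2 → C := ![A, B]
  let e : ∏ᶜ F ⟶ A ⨯ B := prod.lift (Pi.π F 0) (Pi.π F 1)
  let e' : A ⨯ B ⟶ ∏ᶜ F := Pi.lift fun i => match i with
    | 0 => prod.fst
    | 1 => prod.snd
  have h0 : e' ≫ Pi.π F 0 = prod.fst := Pi.lift_π _ _
  have h1 : e' ≫ Pi.π F 1 = prod.snd := Pi.lift_π _ _
  have he : e' ≫ e = 𝟙 _ := by
    refine (prod.comp_lift _ _ _).trans ?_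
    refine (congrArg₂ prod.lift h0 h1).trans ?_
    exact prod.lift_fst_snd
  obtain ⟨o, -, ho⟩ := (hD F).surjOn ((strict_of_section e e' he).comp hf)
  have hfo : f = e' ≫ sumToProd F D o := by
    rw [ho, ← Category.assoc, he, Category.id_comp]
  rcases o with _ | ⟨i, h, hh⟩
  · left
    rw [hfo]
    exact comp_botHom _
  · right
    match i, h, hh, hfo with
    | 0, h, hh, hfo =>
      exact Or.inl ⟨h, hh, hfo.trans ((Category.assoc _ _ _).symm.trans (congrArg (· ≫ h) h0))⟩
    | 1, h, hh, hfo =>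
      exact Or.inr ⟨h, hh, hfo.trans ((Category.assoc _ _ _).symm.trans (congrArg (· ≫ h) h1))⟩

/-- The projection of a context to a variable, as a morphism of `C`. -/
noncomputable def ctxProj (b : C) : {Γ : List Ty} → {T : Ty} → Var Γ T →
    ((coKleisli C).ctx b Γ ⟶ (coKleisli C).ty b T)
  | _ :: _, _, .zero => prod.fst
  | _ :: _, _, .succ x => prod.snd ≫ ctxProj b x

theorem der_ctxProj (b : C) {Γ : List Ty} {T : Ty} (x : Var Γ T) :
    der ((coKleisli C).ctx b Γ) ≫ ctxProj b x = (coKleisli C).lookup b x := by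
  induction x with
  | zero => rfl
  | @succ Γ S T x ih =>
    refine (Category.assoc _ _ _).symm.trans (Eq.trans ?_
      (congrArg ((coKleisli C).comp ((coKleisli C).snd ((coKleisli C).ty b S)
        ((coKleisli C).ctx b Γ))) ih))
    refine Eq.trans ?_ (Category.assoc _ _ _)
    exact congrArg (· ≫ ctxProj b x) (prom_der _).symm

/-- A strict map from a context to a `π`-atomic object is `⊥` or depends on a single variable. -/
theorem strict_ctx_cases {b D : C} (hD : PiAtomic D) {Γ : List Ty}
    (f : (coKleisli C).ctx b Γ ⟶ D) (hf : Strict f) :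
    f = botHom _ _ ∨ ∃ (T : Ty) (x : Var Γ T) (h : (coKleisli C).ty b T ⟶ D),
      Total h ∧ f = ctxProj b x ≫ h := by
  induction Γ with
  | nil =>
    left
    have h : f = 𝟙 (𝟙_ C) ≫ f := (Category.id_comp _).symm
    rw [toUnit_unique (𝟙 (𝟙_ C)) (BottomMaps.bot (𝟙_ C))] at h
    exact h.trans (hf.trans (botHom_unit D).symm)
  | cons S Γ ih =>
    rcases hD.prod_cases (A := (coKleisli C).ty b S) (B := (coKleisli C).ctx b Γ) f hf with
      h | ⟨h, hh, e⟩ | ⟨h, hh, e⟩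
    · exact Or.inl h
    · exact Or.inr ⟨S, .zero, h, hh, e⟩
    · rcases ih h hh.1 with h0 | ⟨T, x, h', hh', e'⟩
      · exact absurd h0 hh.2
      · exact Or.inr ⟨T, x.succ, h', hh',
          e.trans ((congrArg (prod.snd ≫ ·) e').trans (Category.assoc _ _ _).symm)⟩

theorem wellOpened_ty (T : Ty) : wellOpened ((coKleisli C).ty (natObj C) T) := by
  induction T with
  | nat => exact (datatype_mem _).1
  | arr S T _ ih => exact wellOpened_lolli _ _ ih

theorem wellOpened_ctx (Γ : List Ty) : wellOpened ((coKleisli C).ctx (natObj C) Γ) := by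
  induction Γ with
  | nil => exact wellOpened_one
  | cons T Γ ih => exact wellOpened_prod _ _ (wellOpened_ty T) ih

/-! ### Decomposition of morphisms into the base type -/

variable [SequentialCategory C]

/-- The definition of `headCase` as a head application of the branching map to a variable with
its arguments. -/
theorem headCase_eq {Γ Δ : List Ty} (x : Var Γ (arrows Δ Ty.nat))
    (a : ∀ V : Ty, Var Δ V → (bang ((coKleisli C).ctx (natObj C) Γ) ⟶
      (coKleisli C).ty (natObj C) V))
    (g : ℕ → (bang ((coKleisli C).ctx (natObj C) Γ) ⟶ natObj C)) :
    headCase x a g = headAppl (((coKleisli C).applVars (natObj C) Δ (U := Ty.nat)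
        ((coKleisli C).lookup (natObj C) x) a : _ ⟶ natObj C))
      (cases (atomicWO_lolli_nat (bang ((coKleisli C).ctx (natObj C) Γ)))
        (fun n : ULift.{v} ℕ => MonoidalClosed.curry ((ρ_ _).hom ≫ g n.down))) := rfl

/-- A total map out of a datatype is determined by its values. -/
theorem eq_cases {X : Type v} {A : C} (hA : AtomicWO A) {h : datatype X ⟶ A} (hh : Total h) :
    h = cases hA fun x => point x ≫ h :=
  (existsUnique_total hA _).unique ⟨hh, fun _ => rfl⟩
    ⟨(existsUnique_total hA _).choose_spec.1.1, point_cases hA _⟩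

/-- Decomposition theorem: a morphism from a context to `nat` in `K_!(C)` is `⊥`, a numeral, or a
case distinction on the result of applying a variable. -/
theorem decomposition {Γ : List Ty} (f : bang ((coKleisli C).ctx (natObj C) Γ) ⟶ natObj C) :
    f = botHom _ _ ∨ (∃ n : ℕ, f = toUnit _ ≫ point (ULift.up n)) ∨
      ∃ (Δ : List Ty) (x : Var Γ (arrows Δ Ty.nat))
        (a : ∀ V : Ty, Var Δ V → (bang ((coKleisli C).ctx (natObj C) Γ) ⟶
          (coKleisli C).ty (natObj C) V))
        (g : ℕ → (bang ((coKleisli C).ctx (natObj C) Γ) ⟶ natObj C)), f = headCase x a g := by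
  have hdisc : Discrete (natObj C) := SequentialCategory.datatype_discrete _
  have hmem := datatype_mem (C := C) (ULift.{v} ℕ)
  have hW : AtomicWO (lolli (bang ((coKleisli C).ctx (natObj C) Γ)) (natObj C)) :=
    atomicWO_lolli_nat _
  obtain ⟨o, rfl⟩ := (hdisc (bang ((coKleisli C).ctx (natObj C) Γ))).2 f
  rcases o with _ | ⟨f, hf⟩ | ⟨p, hp⟩
  · exact Or.inl rfl
  · refine Or.inr (Or.inr ?_)
    change ∃ Δ x a g, f = _
    -- the head occurrence of the context can be linearized, and is that of a single variable
    obtain ⟨f₁, hf₁, e₁⟩ := (SequentialCategory.head_linearization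
      (wellOpened_ctx (C := C) Γ) hmem.1).surjOn hf.1
    rw [headOccurrence_eq] at e₁
    rcases strict_ctx_cases hW.2.1 f₁ hf₁ with rfl | ⟨T, x, f₂, hf₂, rfl⟩
    · rw [headAppl_botHom] at e₁
      exact absurd e₁.symm hf.2
    obtain ⟨Δ, rfl⟩ := T.exists_arrows
    -- the variable is used as a linear map out of an uncurried function space
    have hk := Total.iso_comp (inv (uncurryVars (natObj C) Δ Ty.nat)) hf₂
    obtain ⟨⟨γ, h⟩, hh, e₂⟩ := (SequentialCategory.linear_extensionality
      (E := (coKleisli C).ctx (natObj C) Γ) hdisc hmem.1 hmem.2.1 hdisc hmem.1 hmem.2.1).surjOn hk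
    have e₃ : f₂ = uncurryVars (natObj C) Δ Ty.nat ≫ linearExt γ h := by
      rw [← IsIso.inv_comp_eq]
      exact e₂.symm
    -- by uniformity of threads the arguments are promoted from a tuple
    have hγ := SequentialCategory.uniformity (wellOpened_ctx Γ) (wellOpened_ctx Δ) γ
    refine ⟨Δ, x, fun V y => (coKleisli C).comp (γ ≫ der _) ((coKleisli C).lookup (natObj C) y),
      fun n => (ρ_ _).inv ≫ MonoidalClosed.uncurry (point (ULift.up n) ≫ h), ?_⟩
    rw [headCase_eq, applVars_eq_linAppl, hγ]
    simp only [Iso.hom_inv_id_assoc, MonoidalClosed.curry_uncurry]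
    have e₄ := eq_cases hW hh
    rw [← e₁, ← headAppl_comp, der_ctxProj, e₃, ← headAppl_comp]
    refine (headAppl_linearExt _ _ _).trans ?_
    exact congrArg (headAppl _) e₄
  · refine Or.inr (Or.inl ?_)
    obtain ⟨o, ho⟩ := (point_bijective (C := C) (ULift.{v} ℕ)).2 p
    rcases o with _ | ⟨n⟩
    · exact absurd ho.symm hp
    · exact ⟨n.down, congrArg (toUnit _ ≫ ·) ho.symm⟩

/-! ### The denotation of case distinctions -/

/-- The linear map that applies an element of `nat ⇒ ⋯ ⇒ nat` to the arguments `q`. Its linearity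
relates `case`, a map into `nat ⇒ ⋯ ⇒ nat`, to the branching maps into `!A ⊸ nat`. -/
noncomputable def linPow {X : C} : (k : ℕ) → (Fin k → (bang X ⟶ natObj C)) →
    ((coKleisli C).ty (natObj C) (natPow k) ⟶ lolli (bang X) (natObj C))
  | 0, _ => MonoidalClosed.curry ((toUnit (bang X) ▷ natObj C) ≫ (λ_ _).hom)
  | k + 1, q => linearExt (prom (q 0)) (linPow k fun i => q i.succ)

theorem headAppl_linPow {X : C} (k : ℕ) (q : Fin k → (bang X ⟶ natObj C))
    (m : bang X ⟶ (coKleisli C).ty (natObj C) (natPow k)) :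
    headAppl m (linPow k q) = (coKleisli C).applPow (natObj C) (X := X) k m q := by
  induction k with
  | zero =>
    rw [headAppl, linPow, MonoidalClosed.uncurry_curry]
    refine (congrArg (con X ≫ ·) (whisker_exchange_assoc _ _ _)).trans ?_
    refine (congrArg (fun z => con X ≫ _ ≫ z) (leftUnitor_naturality _)).trans ?_
    exact con_toUnit_left_assoc _
  | succ k ih =>
    refine (headAppl_linearExt m (prom (q 0)) _).trans ((ih _ _).trans ?_)
    exact congrArg (fun z => (coKleisli C).applPow (natObj C) (X := X) k z fun i => q i.succ)
      (appl_eq_linAppl (A := natObj C) (B := (coKleisli C).ty (natObj C) (natPow k)) m (q 0)).symm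

theorem point_linPow {X : C} (k : ℕ) (q : Fin k → (bang X ⟶ natObj C))
    (p : 𝟙_ C ⟶ (coKleisli C).ty (natObj C) (natPow k)) :
    p ≫ linPow k q = MonoidalClosed.curry ((ρ_ _).hom ≫
      (coKleisli C).applPow (natObj C) (X := X) k (toUnit (bang X) ≫ p) q) := by
  rw [← headAppl_linPow, headAppl_toUnit, Iso.hom_inv_id_assoc, MonoidalClosed.curry_uncurry]

theorem appl_botHom {X A B : C} (a : bang X ⟶ A) :
    (coKleisli C).appl (botHom (bang X) (lolli (bang A) B)) a = botHom (bang X) B := by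
  rw [appl_eq_linAppl, linAppl_botHom]

theorem applPow_botHom {X : C} (k : ℕ) (q : Fin k → (bang X ⟶ natObj C)) :
    (coKleisli C).applPow (natObj C) (X := X) k (botHom _ _) q = botHom _ _ := by
  induction k with
  | zero => rfl
  | succ k ih =>
    exact (congrArg (fun z => (coKleisli C).applPow (natObj C) (X := X) k z fun i => q i.succ)
      (appl_botHom (q 0))).trans (ih _)

theorem toUnit_toPoint {X A : C} (f : bang (𝟙_ C) ⟶ A) :
    toUnit (bang X) ≫ toPoint f = (coKleisli C).comp ((coKleisli C).toOne X) f := by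
  rw [toPoint, toUnit_eq_prom, Category.assoc, Iso.hom_inv_id_assoc]

theorem toUnit_point_ne_botHom (X : C) (n : ULift.{v} ℕ) :
    toUnit X ≫ point n ≠ botHom X (natObj C) := by
  intro e
  have := congrArg (BottomMaps.bot X ≫ ·) e
  exact point_ne_bot n (by simpa [botHom] using this)

/-- Totality does not follow from the values on the arguments `q`, which may all be `⊥`. -/
theorem total_linPow {X : C} (k : ℕ) (q : Fin k → (bang X ⟶ natObj C)) :
    Total (linPow k q) := by
  have hbot : MonoidalClosed.curry ((ρ_ (bang X)).hom ≫ botHom (bang X) (natObj C)) =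
      BottomMaps.bot _ := by
    rw [comp_botHom, curry_botHom, botHom_unit]
  constructor
  · rw [Strict, point_linPow]
    exact (congrArg (fun z => MonoidalClosed.curry ((ρ_ (bang X)).hom ≫ z))
      (applPow_botHom k q)).trans hbot
  · intro e
    -- the constant function with value `0` is not sent to `⊥`
    have h := point_linPow k q (toPoint ((coKleisli C).dummies (natObj C)
      (X := 𝟙_ C) (toUnit (bang (𝟙_ C)) ≫ point ⟨0⟩) k))
    rw [e, comp_botHom, botHom_unit, ← hbot] at h
    have h' := MonoidalClosed.curry_injective h
    rw [cancel_epi, toUnit_toPoint] at h'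
    refine toUnit_point_ne_botHom (C := C) (bang X) ⟨0⟩ ?_
    refine Eq.trans ?_ (((coKleisli C).applPow_dummies (natObj C) _ _ k q).symm.trans h'.symm)
    exact (comp_toUnit_assoc _ _).symm

/-- The morphism that interprets `case`. -/
noncomputable def caseMap (k : ℕ) : natObj C ⟶ (coKleisli C).ty (natObj C) (natPow k) :=
  cases (atomicWO_natPow k) (fun i : ULift.{v} ℕ =>
    if h : i.down < k then toPoint ((coKleisli C).curriedProj (natObj C) k ⟨i.down, h⟩)
    else BottomMaps.bot _)

theorem total_cases {X : Type v} {A : C} (hA : AtomicWO A) (f : X → (𝟙_ C ⟶ A)) :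
    Total (cases hA f) :=
  (existsUnique_total hA f).choose_spec.1.1

/-- `case` followed by application to branches is the total map with these values on the numerals,
because total maps out of a datatype are determined by their values. -/
theorem caseMap_linPow {X : C} (k : ℕ) (g : ℕ → (bang X ⟶ natObj C))
    (hg : ∀ n, k ≤ n → g n = botHom _ _) :
    caseMap k ≫ linPow k (fun i => g i) = cases (atomicWO_lolli_nat (bang X))
      (fun n : ULift.{v} ℕ => MonoidalClosed.curry ((ρ_ _).hom ≫ g n.down)) := by
  have ht : Total (caseMap k ≫ linPow k (fun i => g i)) :=
    total_comp (datatype_mem _) (atomicWO_natPow k) (atomicWO_lolli_nat (bang X)) _ _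
      (total_cases _ _) (total_linPow _ _)
  refine (eq_cases (atomicWO_lolli_nat (bang X)) ht).trans (congrArg _ (funext fun n => ?_))
  rw [← Category.assoc, caseMap, point_cases, point_linPow]
  congr 2
  split_ifs with h
  · rw [toUnit_toPoint]
    exact (coKleisli C).applPow_curriedProj (natObj C) k ⟨n.down, h⟩ _
  · rw [hg _ (not_lt.1 h)]
    exact applPow_botHom k _

end Decomposition

/-! ### Tests on closures of terms -/

namespace PCFModel

variable (M : PCFModel.{v, u})

theorem comp_applVars {X Y : M.Obj} (h : M.Hom X Y) (Δ : List Ty) {U : Ty}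
    (m : M.Hom Y (M.tyObj (arrows Δ U))) (a : ∀ V : Ty, Var Δ V → M.Hom Y (M.tyObj V)) :
    M.comp h (M.applVars M.nat Δ m a) =
      M.applVars M.nat Δ (M.comp h m) (fun V y => M.comp h (a V y)) := by
  induction Δ generalizing U with
  | nil => rfl
  | cons T Δ ih =>
    exact (M.comp_appl _ _ _).trans (congrArg₂ M.appl (ih (U := Ty.arr T U) _ _) rfl)

/-- A test on the names of morphisms out of a context is a test on their closures. -/
theorem exists_test_close {Γ : List Ty} {T : Ty}
    (α : M.Hom (M.exp (M.ctxObj Γ) (M.tyObj T)) M.nat) :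
    ∃ β : M.Hom (M.prod (M.tyObj (arrows Γ T)) M.one) M.nat,
      ∀ f : M.Hom (M.ctxObj Γ) (M.tyObj T),
        M.comp (M.pair (M.close M.nat Γ f) (M.toOne M.one)) β = M.comp (M.name f) α := by
  refine ⟨M.comp (M.fst _ _) (M.comp (M.curry (M.applVars M.nat Γ (M.snd (M.ctxObj Γ) _)
    (fun _ y => M.comp (M.fst _ _) (M.lookup M.nat y)))) α), fun f => ?_⟩
  rw [M.pair_fst_assoc, ← M.assoc, M.comp_curry, comp_applVars, M.pair_snd, name]
  congr 2
  simp only [M.pair_fst_assoc]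
  rw [M.toOne_unique (M.snd (M.ctxObj Γ) M.one)]
  exact M.applVars_close Γ f _

end PCFModel

section FullAbstraction

set_option linter.unusedSectionVars false

variable {C : Type u} [Category.{v} C] [SemiCartesianMonoidalCategory C]
    [SymmetricCategory C] [MonoidalClosed C] [HasFiniteProducts C] [AffineCategory C]
    [BottomMaps C] [StandardDatatypes C]

section Flat

variable [SequentialCategory C] [CpoEnriched C]

theorem coKleisli_comp_case {X : C} (f : bang X ⟶ natObj C) (k : ℕ) :
    (coKleisliModel C).comp f ((coKleisliModel C).case k) = f ≫ caseMap k :=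
  (Category.assoc _ _ _).symm.trans (congrArg (· ≫ caseMap k) (prom_der f))

theorem num_comp_caseMap (k n : ℕ) :
    (coKleisliModel C).num n ≫ caseMap k = toUnit _ ≫
      if h : n < k then toPoint ((coKleisli C).curriedProj (natObj C) k ⟨n, h⟩)
      else BottomMaps.bot _ :=
  (Category.assoc _ _ _).trans (congrArg (toUnit _ ≫ ·) (point_cases _ _ _))

theorem coKleisli_flatBase : (coKleisliModel C).FlatBase where
  num_case k i := by
    rw [coKleisli_comp_case, num_comp_caseMap, dif_pos i.2, toUnit_toPoint]
    exact (coKleisli C).toOne_one_comp _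
  num_case_of_le k n h := by
    rw [coKleisli_comp_case, num_comp_caseMap, dif_neg (not_lt.2 h)]
    rfl
  bot_case k := by
    refine (coKleisli_comp_case _ k).trans ?_
    refine (Category.assoc _ _ _).trans (congrArg (toUnit _ ≫ ·) ?_)
    exact (total_cases _ _).1
  appl_bot a := appl_botHom a
  eq_bot_or_num f := by
    obtain ⟨o, ho⟩ := (point_bijective (C := C) (ULift.{v} ℕ)).2 (toPoint f)
    have hf : f = toUnit _ ≫ toPoint f :=
      (((coKleisli C).toOne_one_comp f).symm).trans (toUnit_toPoint f).symm
    rcases o with _ | ⟨n⟩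
    · exact Or.inl (hf.trans (congrArg (toUnit _ ≫ ·) ho.symm))
    · exact Or.inr ⟨n.down, hf.trans (congrArg (toUnit _ ≫ ·) ho.symm)⟩
  num_ne_bot n := coKleisli_num_ne_bot n
  num_injective m n e := by
    have h := congrArg (fun k => (seelyUnit (C := C)).inv ≫ k) e
    simp only [comp_toUnit_assoc, toUnit_unit, Category.id_comp] at h
    have h' := (point_bijective (C := C) (ULift.{v} ℕ)).1 (a₁ := some ⟨m⟩) (a₂ := some ⟨n⟩) h
    exact congrArg ULift.down (Option.some.inj h')

/-- A case distinction on an applied variable is the denotation of a term, if its parts are and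
almost all its branches are `⊥`. -/
theorem interp_headCase {Γ Δ : List Ty} (x : Var Γ (arrows Δ Ty.nat))
    (A : ∀ V : Ty, Var Δ V → Tm Γ V) (k : ℕ) (G : ℕ → Tm Γ Ty.nat)
    (g : ℕ → (bang ((coKleisli C).ctx (natObj C) Γ) ⟶ natObj C))
    (hG : ∀ n, (coKleisliModel C).interp (G n) = g n) (hg : ∀ n, k ≤ n → g n = botHom _ _) :
    (coKleisliModel C).interp (appPow k (.app (.case k) (Tm.appVars Δ (.var x) A))
      (fun i => G i)) = headCase x (fun V y => (coKleisliModel C).interp (A V y)) g := by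
  have e : (coKleisliModel C).interp (.app (.case k) (Tm.appVars Δ (.var x) A)) =
      (coKleisliModel C).applVars (natObj C) Δ (U := Ty.nat)
        ((coKleisli C).lookup (natObj C) x)
        (fun V y => (coKleisliModel C).interp (A V y)) ≫ caseMap k := by
    refine ((coKleisliModel C).appl_curry _ _).trans ?_
    refine ((coKleisliModel C).pair_fst_assoc _ _ _).trans ?_
    refine (coKleisli_comp_case _ k).trans ?_
    exact congrArg (· ≫ caseMap k) ((coKleisliModel C).interp_appVars Δ (.var x) A)
  refine ((coKleisliModel C).interp_appPow k _ _).trans ?_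
  refine (congrArg₂ ((coKleisli C).applPow (natObj C) (X := (coKleisli C).ctx (natObj C) Γ) k) e
    (funext fun i : Fin k => hG i)).trans ?_
  rw [headCase_eq, ← caseMap_linPow k g hg]
  exact (headAppl_linPow k _ _).symm.trans (headAppl_comp _ _ _)

theorem interp_omega (Γ : List Ty) :
    (coKleisliModel C).interp (.omega : Tm Γ Ty.nat) = botHom _ _ :=
  comp_botHom _

theorem interp_num (Γ : List Ty) (n : ℕ) :
    (coKleisliModel C).interp (.num n : Tm Γ Ty.nat) = toUnit _ ≫ point (ULift.up n) :=
  comp_toUnit_assoc _ _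

/-! ### Observing through compact tests -/

/-- The point `p` of `A ⇒ nat` applied to the point `d` of `A`. -/
noncomputable def test {A : C} (d : bang (𝟙_ C) ⟶ A) (p : 𝟙_ C ⟶ lolli (bang A) (natObj C)) :
    bang (𝟙_ C) ⟶ natObj C :=
  linAppl (prom d) (toUnit _ ≫ p)

theorem test_scottContinuous {A : C} (d : bang (𝟙_ C) ⟶ A) : ScottContinuous (test d) := by
  unfold test linAppl
  exact (((CpoEnriched.comp_left _).comp (CpoEnriched.whiskerLeft _)).comp
    (CpoEnriched.comp_right _)).comp (CpoEnriched.comp_left _)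

theorem test_toPoint_curry {A : C} (d : bang (𝟙_ C) ⟶ A) (β : bang (A ⨯ 𝟙_ C) ⟶ natObj C) :
    test d (toPoint ((coKleisli C).curry β)) =
      (coKleisli C).comp ((coKleisli C).pair d ((coKleisli C).toOne (𝟙_ C))) β := by
  rw [test, toUnit_toPoint, ← appl_eq_linAppl]
  exact (coKleisli C).appl_comp_curry _ _ _

/-- A test that succeeds has a compact approximation that succeeds. -/
theorem exists_compact_test {A : C} (d : bang (𝟙_ C) ⟶ A)
    (p : 𝟙_ C ⟶ lolli (bang A) (natObj C)) (n : ℕ)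
    (h : test d p = (coKleisliModel C).num n) :
    ∃ c, IsCompactElement c ∧ c ≤ p ∧ test d c = (coKleisliModel C).num n := by
  by_contra! hc
  obtain ⟨h1, h2, h3⟩ := CpoEnriched.algebraic p
  have hl := test_scottContinuous d h1 h2 h3
  refine coKleisli_num_ne_bot (C := C) n (le_antisymm ?_ (CpoEnriched.bot_le _))
  refine h.symm.le.trans (hl.2 ?_)
  rintro _ ⟨c, ⟨hc1, hc2⟩, rfl⟩
  have hle : test d c ≤ (coKleisliModel C).num n :=
    h ▸ (test_scottContinuous d).monotone hc2
  exact ((coKleisli_flat hle).resolve_right (hc c hc1 hc2)).le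

end Flat

variable [NormedSequentialCategory C]

/-! ### Definability and completeness -/

/-- Every compact morphism from a context to a type is the denotation of a term. The induction is on
the norm, and within that on the type: uncurrying does not change the closure of a morphism, and at
base type the decomposition theorem reduces to morphisms of smaller norm. -/
theorem definability {Γ : List Ty} {U : Ty}
    (f : bang ((coKleisli C).ctx (natObj C) Γ) ⟶ (coKleisli C).ty (natObj C) U)
    (hf : IsCompactElement (closedPoint Γ f)) :
    ∃ P : Tm Γ U, (coKleisliModel C).interp P = f := by
  obtain ⟨N, hN⟩ : ∃ N, NormedSequentialCategory.norm ⟨closedPoint Γ f, hf⟩ = N := ⟨_, rfl⟩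
  induction N using Nat.strong_induction_on generalizing Γ U with
  | _ N ih =>
  induction U generalizing Γ with
  | arr S T _ ihT =>
    -- `f` is the currying of a morphism with the same closure
    obtain ⟨f, rfl⟩ : ∃ f', (coKleisli C).curry f' = f := ⟨_, (coKleisli C).curry_eta f⟩
    obtain ⟨P, hP⟩ := ihT (Γ := S :: Γ) f hf hN
    exact ⟨.lam P, congrArg (coKleisli C).curry hP⟩
  | nat =>
    rcases decomposition f with rfl | ⟨n, rfl⟩ | ⟨Δ, x, a, g, rfl⟩
    · exact ⟨.omega, interp_omega Γ⟩
    · exact ⟨.num n, interp_num Γ n⟩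
    obtain ⟨ha, hg, hfin⟩ := NormedSequentialCategory.norm_headCase x a g hf
    have hA : ∀ (V : Ty) (y : Var Δ V), ∃ P : Tm Γ V, (coKleisliModel C).interp P = a V y := by
      intro V y
      obtain ⟨hc, hlt⟩ := ha V y
      exact ih _ (hlt.trans_eq hN) _ hc rfl
    have hG : ∀ n, ∃ P : Tm Γ Ty.nat, (coKleisliModel C).interp P = g n := by
      intro n
      obtain ⟨hc, hlt⟩ := hg n
      exact ih _ (hlt.trans_eq hN) (U := Ty.nat) _ hc rfl
    choose A hA using hA
    choose G hG using hG
    obtain ⟨k, hk⟩ := hfin.bddAbove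
    refine ⟨_, (interp_headCase x A (k + 1) G g hG fun n hn => ?_).trans ?_⟩
    · by_contra h
      exact absurd (hk h) (by omega)
    · congr 1
      funext V y
      exact hA V y

theorem coKleisliQuotient_complete : (coKleisliQuotient C).Complete := by
  intro Γ T P Q hobs
  have hle : (coKleisliModel C).IntrinsicLE ((coKleisliModel C).interp P)
      ((coKleisliModel C).interp Q) := by
    intro α n e
    obtain ⟨β, hβ⟩ := (coKleisliModel C).exists_test_close α
    have htest : ∀ R : Tm Γ T, test ((coKleisliModel C).interp (Tm.closure Γ R))
        (toPoint ((coKleisli C).curry β)) =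
        (coKleisliModel C).comp ((coKleisliModel C).name ((coKleisliModel C).interp R)) α := by
      intro R
      rw [PCFModel.interp_closure]
      exact (test_toPoint_curry _ _).trans (hβ _)
    rw [← htest] at e ⊢
    obtain ⟨c, hc, hcβ, hcP⟩ := exists_compact_test _ _ n e
    -- `1 ⟶ (A ⇒ nat)` and `A × 1 ⟶ nat` correspond in `K_!(C)`, so the test has this form
    obtain ⟨c', rfl⟩ : ∃ c', toPoint ((coKleisli C).curry c') = c := by
      refine ⟨_, (congrArg toPoint ((coKleisli C).curry_eta (seelyUnit.hom ≫ c))).trans ?_⟩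
      exact Iso.inv_hom_id_assoc _ _
    -- the compact test is the denotation of a term with one free variable
    obtain ⟨L, hL⟩ := definability (Γ := [arrows Γ T]) (U := Ty.nat) c' hc
    have hplug : ∀ R : Tm Γ T, ((Ctxt.app (.term (.lam L))
        (Ctxt.closure Γ (.hole (fun _ x => x) fun _ _ _ h => h)) : Ctxt Γ T [] Ty.nat).plug R) =
        .app (.lam L) (Tm.closure Γ R) := by
      intro R
      exact congrArg (Tm.app _) ((Ctxt.plug_closure R Γ _).trans
        (congrArg (Tm.closure Γ) (Tm.rename_id R)))
    have hinterp : ∀ R : Tm Γ T, (coKleisliModel C).interp (.app (.lam L) (Tm.closure Γ R)) =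
        test ((coKleisliModel C).interp (Tm.closure Γ R)) (toPoint ((coKleisli C).curry c')) := by
      intro R
      refine ((coKleisliModel C).appl_curry _ _).trans (Eq.trans ?_ (test_toPoint_curry _ _).symm)
      rw [hL]
      exact congrArg (fun z => (coKleisliModel C).comp ((coKleisliModel C).pair _ z) c')
        ((coKleisliModel C).toOne_eq_id).symm
    have hev := hobs _ n (by
      rw [hplug, coKleisli_flatBase.eval_iff (coKleisli_observable C), hinterp]
      exact hcP)
    rw [hplug, coKleisli_flatBase.eval_iff (coKleisli_observable C), hinterp] at hev
    exact coKleisli_eq_num (hev.symm.le.trans ((test_scottContinuous _).monotone hcβ))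
  change ((coKleisliModel C).qhomOrder _ _).le
    (((coKleisliModel C).quotientModel (coKleisli_observable C)).interp P)
    (((coKleisliModel C).quotientModel (coKleisli_observable C)).interp Q)
  rw [PCFModel.quotient_interp, PCFModel.quotient_interp]
  exact hle
end FullAbstraction
end AxPCF

theorem theorem8p4 (C : Type u) [Category.{v} C] [SemiCartesianMonoidalCategory C]
    [SymmetricCategory C] [MonoidalClosed C] [HasFiniteProducts C] [AxPCF.AffineCategory C]
    [AxPCF.BottomMaps C] [AxPCF.StandardDatatypes C] [AxPCF.NormedSequentialCategory C] :
    (AxPCF.coKleisliQuotient C).FullyAbstract :=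
  ⟨AxPCF.coKleisli_flatBase.sound (AxPCF.coKleisli_observable C),
    AxPCF.coKleisliQuotient_complete⟩
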